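/- **Lemma (Claw Property).** Let $G=(V,E,c)$ be a finite graph with edge costs $c\ge 0$, let $d$ be the shortest-path distance ($d=\infty$ if there is no path), let $t:V\to\mathbb R_{\ge0}$ and $0<\beta<1$. *Moat growing.* Given $t':V\to\mathbb R_{\ge0}$, the moat-growing execution with fingerprint $t'$ runs in continuous time from moment $0$, with growths $y_S=0$ for all $S\subseteq V$ at the start. At each moment an edge $e$ is fully coloured if $\sum_{S:\,e\in\delta(S)}y_S=c_e$, where $\delta(S)$ is the set of edges with exactly one endpoint in $S$; the components are the connected components of $V$ with respect to the fully coloured edges; a component $S$ is active at moment $\tau$ if $t'_a>\tau$ for some $a\in S$; and $y_S$ grows at unit rate exactly for the active $S$. Deactivation is checked after merging, so a component just formed from an active set counts as an active set at that moment, even if it is deactivated at once. Let $y_{\mathrm{base}}(t')$ be the total growth of active sets $S$ during moments $\tau$ with $\tau<t_a$ for some $a\in S$, and $y_{\mathrm{add}}(t')$ the total growth during the other moments. *Local search.* A boost $(a,\sigma)$ replaces the value $t'_a$ by $\sigma$, giving $t''$; it is valuable for $t'$ if $$y_{\mathrm{base}}(t')-y_{\mathrm{base}}(t'')\ \ge\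 (1+\beta)\,\bigl(y_{\mathrm{add}}(t'')-y_{\mathrm{add}}(t')\bigr).$$ The boosts considered for $t'$ are the pairs $(a,\sigma)$ such that $\sigma>t'_a$ and, in the execution in which $t'_a$ is replaced by a sufficiently large number, the active set containing $a$ merges with another active set at moment $\sigma$. Local search on $(G,t,\beta)$ starts with $t'=t$, repeatedly applies a considered valuable boost, and stops when there is none. *Claim.* Let $t'$ be the fingerprint at the end of a local search on $(G,t,\beta)$, and consider the execution with fingerprint $t'$. Let $u,v,w\in V$ connect actively, that is, each of them remains in active sets from the beginning until they all lie in a common component, which is an active set. Then there is a first moment $\tau$ at which at least two of $u,v,w$ belong to the same active set, and a first moment $\tau'$ at which all three belong to the same active set, and for every vertex $q$ $$\tau+\tau'\ \le\ \frac{d(q,u)+d(q,v)+d(q,w)}{2}+\beta\,\frac{\min\bigl(d(q,u),d(q,v),d(q,w)\bigr)}{2}.$$ -/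

import Mathlib

open scoped NNReal ENNReal

/-- A graph with nonnegative edge costs (only the values of `cost` on edges of `graph` matter). -/
structure CostGraph (V : Type*) where
  graph : SimpleGraph V
  cost : Sym2 V → ℝ≥0

namespace CostGraph

/-- Total cost of the edges of a walk. -/
noncomputable def walkCost {V : Type*} (G : CostGraph V) {a b : V} (p : G.graph.Walk a b) : ℝ≥0 :=
  (p.edges.map G.cost).sum

/-- Shortest-path distance; it is `⊤` when no path exists. -/
noncomputable def dist {V : Type*} (G : CostGraph V) (a b : V) : ℝ≥0∞ :=
  ⨅ p : G.graph.Walk a b, (G.walkCost p : ℝ≥0∞)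

/-- The data that moat growing maintains: the current moment and the growth `y_S` accumulated so far
by every set `S` of vertices. -/
structure State (V : Type*) where
  time : ℝ
  growth : Finset V → ℝ

open scoped Classical in
/-- The coloured length of the edge `ab`: the sum of `y_S` over the sets `S` that contain exactly one
of `a`, `b`. -/
noncomputable def State.colored {V : Type*} [Fintype V] (s : State V) (a b : V) : ℝ :=
  ∑ S : Finset V with (a ∈ S ↔ b ∉ S), s.growth S

/-- The graph of the fully coloured edges. (The coloured length of an edge never exceeds its cost,
so `≤` amounts to equality.) -/
def coloredGraph {V : Type*} [Fintype V] (G : CostGraph V) (s : State V) : SimpleGraph V where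
  Adj a b := G.graph.Adj a b ∧ (G.cost s(a, b) : ℝ) ≤ s.colored a b
  symm := ⟨fun a b h => by
    refine ⟨h.1.symm, ?_⟩
    have e : s.colored b a = s.colored a b := by
      unfold State.colored
      congr 1
      ext S
      simp only [Finset.mem_filter, Finset.mem_univ, true_and]
      tauto
    rw [e, Sym2.eq_swap]
    exact h.2⟩
  loopless := ⟨fun a h => G.graph.loopless.irrefl a h.1⟩

open scoped Classical in
/-- The connected component of `a` with respect to the fully coloured edges. -/
noncomputable def component {V : Type*} [Fintype V] (G : CostGraph V) (s : State V) (a : V) :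
    Finset V :=
  Finset.univ.filter fun b => (G.coloredGraph s).Reachable a b

open scoped Classical in
/-- All current connected components. -/
noncomputable def components {V : Type*} [Fintype V] (G : CostGraph V) (s : State V) :
    Finset (Finset V) :=
  Finset.univ.image (G.component s)

open scoped Classical in
/-- The active sets for the fingerprint `t`: the components that contain a vertex whose required
growing time is not yet over. -/
noncomputable def activeSets {V : Type*} [Fintype V] (G : CostGraph V) (t : V → ℝ≥0)
    (s : State V) : Finset (Finset V) :=
  (G.components s).filter fun S => ∃ a ∈ S, s.time < t a

open scoped Classical in
/-- The waiting times until an edge between two different components, at least one of which is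
active, becomes fully coloured, if nothing else happens before. -/
def edgeWaits {V : Type*} [Fintype V] (G : CostGraph V) (t : V → ℝ≥0) (s : State V) : Set ℝ :=
  {δ | ∃ a b, G.graph.Adj a b ∧ G.component s a ≠ G.component s b ∧
    (({G.component s a, G.component s b} : Finset (Finset V)) ∩ G.activeSets t s).Nonempty ∧
    δ = (G.cost s(a, b) - s.colored a b) /
      (({G.component s a, G.component s b} : Finset (Finset V)) ∩ G.activeSets t s).card}

/-- The waiting times until the required growing time of a vertex is over. -/
def vertexWaits {V : Type*} (t : V → ℝ≥0) (s : State V) : Set ℝ :=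
  {δ | ∃ a, s.time < t a ∧ δ = t a - s.time}

/-- The waiting time until the next event, the minimum of a finite set. This set is empty exactly
if there is no active set; the process is then over, and the value is `0`. -/
noncomputable def wait {V : Type*} [Fintype V] (G : CostGraph V) (t : V → ℝ≥0) (s : State V) : ℝ :=
  sInf (G.edgeWaits t s ∪ vertexWaits t s)

open scoped Classical in
/-- Let all active sets grow until the next event. -/
noncomputable def step {V : Type*} [Fintype V] (G : CostGraph V) (t : V → ℝ≥0) (s : State V) :
    State V where
  time := s.time + G.wait t s
  growth S := s.growth S + if S ∈ G.activeSets t s then G.wait t s else 0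

/-- The execution of moat growing with fingerprint `t`, from event to event. -/
noncomputable def run {V : Type*} [Fintype V] (G : CostGraph V) (t : V → ℝ≥0) : ℕ → State V
  | 0 => ⟨0, fun _ => 0⟩
  | n + 1 => G.step t (run G t n)

/-- The moment `τ` falls into the phase between the events `n` and `n + 1` (the phase in which there
is no active set any more lasts forever). -/
def InPhase {V : Type*} [Fintype V] (G : CostGraph V) (t : V → ℝ≥0) (n : ℕ) (τ : ℝ) : Prop :=
  (G.run t n).time ≤ τ ∧ (τ < (G.run t (n + 1)).time ∨ G.activeSets t (G.run t n) = ∅)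

/-- `S` is a connected component at the moment `τ` (after all merges at this moment). -/
def IsComponentAt {V : Type*} [Fintype V] (G : CostGraph V) (t : V → ℝ≥0) (τ : ℝ)
    (S : Finset V) : Prop :=
  ∃ n, G.InPhase t n τ ∧ S ∈ G.components (G.run t n)

/-- `S` is active and growing during `[τ, τ + ε)` for some `ε > 0`. -/
def GrowsAt {V : Type*} [Fintype V] (G : CostGraph V) (t : V → ℝ≥0) (τ : ℝ)
    (S : Finset V) : Prop :=
  ∃ n, G.InPhase t n τ ∧ S ∈ G.activeSets t (G.run t n)

/-- `S` is active and growing during `(τ - ε, τ)` for some `ε > 0`. -/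
def GrowsUntil {V : Type*} [Fintype V] (G : CostGraph V) (t : V → ℝ≥0) (τ : ℝ)
    (S : Finset V) : Prop :=
  ∃ n, (G.run t n).time < τ ∧ τ ≤ (G.run t (n + 1)).time ∧ S ∈ G.activeSets t (G.run t n)

/-- `S` is an active set at the moment `τ`. Deactivation is checked after the merges: a component
that has just been formed from an active set is active at this moment, even if it is deactivated
at once. -/
def IsActiveAt {V : Type*} [Fintype V] (G : CostGraph V) (t : V → ℝ≥0) (τ : ℝ)
    (S : Finset V) : Prop :=
  G.IsComponentAt t τ S ∧ (G.GrowsAt t τ S ∨ ∃ S' ⊆ S, G.GrowsUntil t τ S')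

/-- The vertices of `A` connect actively: all of them remain in active sets from the beginning until
a moment `σ` at which they lie in one and the same component, an active set (which may be
deactivated at once). -/
def ActivelyConnected {V : Type*} [Fintype V] (G : CostGraph V) (t : V → ℝ≥0) (A : Set V) : Prop :=
  ∃ σ : ℝ, (∃ S, G.IsActiveAt t σ S ∧ A ⊆ S) ∧
    ∀ a ∈ A, ∀ τ : ℝ, 0 ≤ τ → τ < σ → ∃ S, G.GrowsAt t τ S ∧ a ∈ S

open MeasureTheory in
/-- The base growth of the boosted instance `(G, t, t')`: the total growth of the active sets, in the
execution with the boosted fingerprint `t'`, while they contain a vertex `a` with `τ < t a`. -/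
noncomputable def yBase {V : Type*} [Fintype V] (G : CostGraph V) (t t' : V → ℝ≥0) : ℝ :=
  ∑ S : Finset V, volume.real {τ : ℝ | G.GrowsAt t' τ S ∧ ∃ a ∈ S, τ < t a}

open MeasureTheory in
/-- The additional growth of the boosted instance `(G, t, t')`: the total growth of the active sets
while they contain no vertex `a` with `τ < t a`. -/
noncomputable def yAdd {V : Type*} [Fintype V] (G : CostGraph V) (t t' : V → ℝ≥0) : ℝ :=
  ∑ S : Finset V, volume.real {τ : ℝ | G.GrowsAt t' τ S ∧ ∀ a ∈ S, t a ≤ τ}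

open scoped Classical in
/-- The boost action `(a, σ)` applied to the boosted fingerprint `t'`. -/
noncomputable def boost {V : Type*} (t' : V → ℝ≥0) (a : V) (σ : ℝ≥0) : V → ℝ≥0 :=
  Function.update t' a σ

/-- The decrease of the base growth caused by the boost `(a, σ)`. -/
noncomputable def win {V : Type*} [Fintype V] (G : CostGraph V) (t t' : V → ℝ≥0) (a : V)
    (σ : ℝ≥0) : ℝ :=
  G.yBase t t' - G.yBase t (boost t' a σ)

/-- The increase of the additional growth caused by the boost `(a, σ)`. -/
noncomputable def loss {V : Type*} [Fintype V] (G : CostGraph V) (t t' : V → ℝ≥0) (a : V)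
    (σ : ℝ≥0) : ℝ :=
  G.yAdd t (boost t' a σ) - G.yAdd t t'

/-- The boost `(a, σ)` is valuable. -/
def IsValuable {V : Type*} [Fintype V] (G : CostGraph V) (t : V → ℝ≥0) (β : ℝ) (t' : V → ℝ≥0)
    (a : V) (σ : ℝ≥0) : Prop :=
  (1 + β) * G.loss t t' a σ ≤ G.win t t' a σ

/-- The space of boost actions: `σ` exceeds `t' a`, and in the execution in which the value at `a` is
replaced by a sufficiently large number `T`, the active set containing `a` merges with another
active set at the moment `σ`. -/
def IsCandidate {V : Type*} [Fintype V] (G : CostGraph V) (t' : V → ℝ≥0) (a : V)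
    (σ : ℝ≥0) : Prop :=
  t' a < σ ∧ ∀ᶠ T : ℝ≥0 in Filter.atTop, ∃ S S' C : Finset V,
    a ∈ S ∧ S ≠ S' ∧ G.GrowsUntil (boost t' a T) σ S ∧ G.GrowsUntil (boost t' a T) σ S' ∧
    G.IsComponentAt (boost t' a T) σ C ∧ S ⊆ C ∧ S' ⊆ C

/-- One iteration of local search: some valuable boost of the boost space is applied. -/
def LocalSearchStep {V : Type*} [Fintype V] (G : CostGraph V) (t : V → ℝ≥0) (β : ℝ)
    (t₁ t₂ : V → ℝ≥0) : Prop :=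
  ∃ a σ, G.IsCandidate t₁ a σ ∧ G.IsValuable t β t₁ a σ ∧ t₂ = boost t₁ a σ

/-- `t'` is the boosted fingerprint at the end of a call of local search on `(G, t, β)`: it arises
from `t` by iterations, and no valuable boost remains. -/
def IsLocalSearchOutput {V : Type*} [Fintype V] (G : CostGraph V) (t : V → ℝ≥0) (β : ℝ)
    (t' : V → ℝ≥0) : Prop :=
  Relation.ReflTransGen (G.LocalSearchStep t β) t t' ∧
    ∀ a σ, G.IsCandidate t' a σ → ¬ G.IsValuable t β t' a σ

end CostGraph

/-! Write `τ₁ ≤ τ₂` for the two merging moments. Fix the centre `q` and consider the execution in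
which the value of `q` is raised so far that `q` stays active at least until `τ₂`. For `x` among `u,
v, w`, let `ρx` be the first moment at which `q` and `x` are joined in it, capped at `τ₂`. Until
`ρx` the two vertices lie in different active sets, so every path between them is coloured from both
ends, and `2 * ρx` is at most their distance (`ofReal_le_dist_div_two`). It therefore suffices to
prove, for `ρu ≤ ρv ≤ ρw`, that `τ₁ + τ₂ ≤ ρu + ρv + ρw + β * ρu` (`add_le_of_merging_moments`).

From `ρu` on, `q` belongs to the component of `u`, which stays active until `τ₂` anyway. Raising the
value of `q` beyond `ρu` thus has no effect on the components up to `τ₂`. If `ρu ≤ t' q`, the merges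
with `q` already happen under `t'`, whence `τ₁ ≤ ρv` and `τ₂ ≤ ρw`. Otherwise `(q, ρu)` is a
considered boost, hence not valuable.

A boost is valuable exactly if `yBase + (1 + β) * yAdd` does not increase. This quantity is the
integral over time of the total weight of the active sets, with weight `1` for base and `1 + β` for
additional growth. At each moment the boost adds at most one active set, that of `q`, of weight at
most `1 + β`, and only before `ρu`. Every merge of active sets saves at least `1`
(`totalWeight_add_le`). One merge is gained from `ρv` to `τ₁`, another from `ρw` to `τ₂`. If the
inequality failed, these savings would pay for the boost (`isValuable_boost`), a contradiction.

Executions are compared through the monotonicity principle `joined_of_joined`, proved by induction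
along real time: the component structure is right-continuous, and coloured lengths pass to left
limits. -/

/-- A walk in a graph whose edges join reachable vertices of another graph. -/
theorem SimpleGraph.Reachable.of_adj_reachable {V : Type*} {H K : SimpleGraph V}
    (h : ∀ a b, H.Adj a b → K.Reachable a b) {a b : V} (hab : H.Reachable a b) :
    K.Reachable a b := by
  obtain ⟨p⟩ := hab
  induction p with
  | nil => exact SimpleGraph.Reachable.refl _
  | cons hadj _ ih => exact (h _ _ hadj).trans ih

/-- Induction along the nonnegative reals. -/
theorem nonneg_real_induction {P : ℝ → Prop} (h0 : P 0)
    (right : ∀ τ, 0 ≤ τ → P τ → ∃ ε > 0, ∀ σ, τ ≤ σ → σ < τ + ε → P σ)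
    (left : ∀ τ, 0 < τ → (∀ σ, 0 ≤ σ → σ < τ → P σ) → P τ) : ∀ τ, 0 ≤ τ → P τ := by
  by_contra! hcon
  set B : Set ℝ := {τ | 0 ≤ τ ∧ ¬ P τ} with hB
  have hne : B.Nonempty := hcon
  have hbd : BddBelow B := ⟨0, fun x hx => hx.1⟩
  have hm0 : 0 ≤ sInf B := le_csInf hne fun x hx => hx.1
  have hlt : ∀ σ, 0 ≤ σ → σ < sInf B → P σ := fun σ h1 h2 => by
    by_contra h
    exact absurd (csInf_le hbd ⟨h1, h⟩) (not_le.2 h2)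
  have hP : P (sInf B) := by
    rcases hm0.eq_or_lt with h | h
    · rwa [← h]
    · exact left _ h hlt
  obtain ⟨ε, hε, hr⟩ := right _ hm0 hP
  obtain ⟨x, hx, hxl⟩ := exists_lt_of_csInf_lt hne (lt_add_of_pos_right (sInf B) hε)
  exact hx.2 (hr x (csInf_le hbd hx) hxl)

/-! ### Growth between two events -/

namespace CostGraph

variable {V : Type*} [Fintype V] (G : CostGraph V) (t : V → ℝ≥0)

/-- Let all active sets grow for time `δ`. -/
noncomputable def advance (s : State V) (δ : ℝ) : State V :=
  open scoped Classical in
  { time := s.time + δ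
    growth := fun S => s.growth S + if S ∈ G.activeSets t s then δ else 0 }

theorem step_eq_advance (s : State V) : G.step t s = G.advance t s (G.wait t s) := rfl

theorem advance_zero (s : State V) : G.advance t s 0 = s := by
  simp [advance]

theorem mem_component {s : State V} {a b : V} :
    b ∈ G.component s a ↔ (G.coloredGraph s).Reachable a b := by
  simp [component]

theorem component_eq_iff {s : State V} {a b : V} :
    G.component s a = G.component s b ↔ (G.coloredGraph s).Reachable a b := by
  constructor
  · intro h
    rw [← mem_component, h, mem_component]
  · intro h
    ext c
    rw [mem_component, mem_component]
    exact ⟨h.symm.trans, h.trans⟩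

theorem mem_components {s : State V} {S : Finset V} :
    S ∈ G.components s ↔ ∃ a, G.component s a = S := by
  simp [components]

theorem component_eq_of_mem {s : State V} {S : Finset V} {a : V} (hS : S ∈ G.components s)
    (ha : a ∈ S) : G.component s a = S := by
  obtain ⟨b, rfl⟩ := (G.mem_components).1 hS
  exact ((G.component_eq_iff).2 ((G.mem_component).1 ha)).symm

theorem self_mem_component (s : State V) (a : V) : a ∈ G.component s a :=
  (G.mem_component).2 (SimpleGraph.Reachable.refl _)

/-- The component of `a` is active. -/
def IsActive (s : State V) (a : V) : Prop := ∃ b, (G.coloredGraph s).Reachable a b ∧ s.time < t b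

theorem mem_activeSets {s : State V} {S : Finset V} :
    S ∈ G.activeSets t s ↔ ∃ a, G.component s a = S ∧ G.IsActive t s a := by
  simp only [activeSets, Finset.mem_filter, mem_components, IsActive]
  constructor
  · rintro ⟨⟨a, rfl⟩, b, hb, h⟩
    exact ⟨a, rfl, b, (G.mem_component).1 hb, h⟩
  · rintro ⟨a, rfl, b, hb, h⟩
    exact ⟨⟨a, rfl⟩, b, (G.mem_component).2 hb, h⟩

theorem component_mem_activeSets {s : State V} {a : V} :
    G.component s a ∈ G.activeSets t s ↔ G.IsActive t s a := by
  rw [mem_activeSets]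
  constructor
  · rintro ⟨b, h, c, hc, hl⟩
    exact ⟨c, ((G.component_eq_iff).1 h).symm.trans hc, hl⟩
  · exact fun h => ⟨a, rfl, h⟩

theorem mem_components_of_mem_activeSets {s : State V} {S : Finset V}
    (h : S ∈ G.activeSets t s) : S ∈ G.components s := by
  obtain ⟨a, rfl, -⟩ := (G.mem_activeSets t).1 h
  exact (G.mem_components).2 ⟨a, rfl⟩

open scoped Classical in
/-- The rate at which the component of `a` grows. -/
noncomputable def rate (s : State V) (a : V) : ℝ := if G.IsActive t s a then 1 else 0

theorem rate_nonneg (s : State V) (a : V) : 0 ≤ G.rate t s a := by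
  unfold rate; split_ifs <;> norm_num

open scoped Classical in
theorem card_inter_activeSets {s : State V} {a b : V}
    (h : ¬ (G.coloredGraph s).Reachable a b) :
    ((({G.component s a, G.component s b} : Finset (Finset V)) ∩ G.activeSets t s).card : ℝ) =
      G.rate t s a + G.rate t s b := by
  have hne : G.component s a ≠ G.component s b := fun h' => h ((G.component_eq_iff).1 h')
  have e : (({G.component s a, G.component s b} : Finset (Finset V)) ∩ G.activeSets t s) =
      ({G.component s a, G.component s b} : Finset (Finset V)).filter
        (· ∈ G.activeSets t s) := by
    ext; simp
  rw [e, Finset.filter_insert, Finset.filter_singleton]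
  simp only [component_mem_activeSets, rate]
  split_ifs <;> simp [hne]; norm_num

/-- An active set is a whole component, so it contains both or neither of two vertices that are
already joined. -/
theorem colored_advance_of_reachable {s : State V} {a b : V}
    (h : (G.coloredGraph s).Reachable a b) (δ : ℝ) :
    (G.advance t s δ).colored a b = s.colored a b := by
  classical
  unfold State.colored advance
  refine Finset.sum_congr rfl fun S hS => ?_
  rw [Finset.mem_filter] at hS
  have : S ∉ G.activeSets t s := by
    intro hmem
    obtain ⟨c, rfl, -⟩ := (G.mem_activeSets t).1 hmem
    have h1 := hS.2
    rw [mem_component, mem_component] at h1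
    have : (G.coloredGraph s).Reachable c a ↔ (G.coloredGraph s).Reachable c b :=
      ⟨fun h' => h'.trans h, fun h' => h'.trans h.symm⟩
    tauto
  simp [this]

/-- The growing sets that separate `a` from `b` are precisely the active ones among their two
components. -/
theorem colored_advance {s : State V} {a b : V}
    (h : ¬ (G.coloredGraph s).Reachable a b) (δ : ℝ) :
    (G.advance t s δ).colored a b = s.colored a b + δ * (G.rate t s a + G.rate t s b) := by
  classical
  rw [← card_inter_activeSets G t h]
  unfold State.colored advance
  simp only
  rw [Finset.sum_add_distrib, ← Finset.sum_filter, Finset.sum_const, nsmul_eq_mul, mul_comm δ]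
  congr 4
  ext S
  simp only [Finset.mem_filter, Finset.mem_univ, true_and, Finset.mem_inter, Finset.mem_insert,
    Finset.mem_singleton, and_congr_left_iff]
  intro hS
  obtain ⟨c, rfl, -⟩ := (G.mem_activeSets t).1 hS
  rw [component_eq_iff, component_eq_iff, mem_component, mem_component]
  constructor
  · tauto
  · rintro (h1 | h1)
    · exact ⟨fun _ h2 => h (h1.symm.trans h2), fun _ => h1⟩
    · exact ⟨fun h2 _ => h (h2.symm.trans h1), fun h2 => absurd h1 h2⟩

theorem colored_le_colored_advance (s : State V) {δ : ℝ} (hδ : 0 ≤ δ) (a b : V) :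
    s.colored a b ≤ (G.advance t s δ).colored a b := by
  by_cases h : (G.coloredGraph s).Reachable a b
  · rw [colored_advance_of_reachable G t h]
  · rw [colored_advance G t h]
    have := mul_nonneg hδ (add_nonneg (G.rate_nonneg t s a) (G.rate_nonneg t s b))
    linarith

/-- Fully coloured edges remain so if the coloured lengths increase. -/
theorem reachable_of_colored_le {s s' : State V}
    (h : ∀ a b, s.colored a b ≤ s'.colored a b) {a b : V}
    (hab : (G.coloredGraph s).Reachable a b) : (G.coloredGraph s').Reachable a b :=
  hab.of_adj_reachable (K := G.coloredGraph s') fun a b (hadj : (G.coloredGraph s).Adj a b) =>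
    SimpleGraph.Adj.reachable ⟨hadj.1, hadj.2.trans (h a b)⟩

theorem edgeWaits_union_vertexWaits_finite (s : State V) :
    (G.edgeWaits t s ∪ vertexWaits t s).Finite := by
  classical
  refine Set.Finite.union ?_ ?_
  · refine (Set.finite_range fun p : V × V => ((G.cost s(p.1, p.2) : ℝ) - s.colored p.1 p.2) /
      ((({G.component s p.1, G.component s p.2} : Finset (Finset V)) ∩
        G.activeSets t s).card : ℝ)).subset ?_
    rintro δ ⟨a, b, -, -, -, h⟩
    refine ⟨(a, b), ?_⟩
    rw [h]
  · refine (Set.finite_range fun a => (t a : ℝ) - s.time).subset ?_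
    rintro δ ⟨a, -, rfl⟩
    exact ⟨a, rfl⟩

theorem wait_le {s : State V} {δ : ℝ} (h : δ ∈ G.edgeWaits t s ∪ vertexWaits t s) :
    G.wait t s ≤ δ :=
  csInf_le (G.edgeWaits_union_vertexWaits_finite t s).bddBelow h

theorem wait_mem {s : State V} (h : (G.activeSets t s).Nonempty) :
    G.wait t s ∈ G.edgeWaits t s ∪ vertexWaits t s := by
  refine Set.Nonempty.csInf_mem ?_ (G.edgeWaits_union_vertexWaits_finite t s)
  obtain ⟨S, hS⟩ := h
  obtain ⟨a, -, b, -, hb⟩ := (G.mem_activeSets t).1 hS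
  exact ⟨_, Or.inr ⟨b, hb, rfl⟩⟩

theorem colored_lt_cost {s : State V} {a b : V} (hadj : G.graph.Adj a b)
    (h : ¬ (G.coloredGraph s).Reachable a b) : s.colored a b < G.cost s(a, b) := by
  by_contra hcon
  exact h (SimpleGraph.Adj.reachable ⟨hadj, not_lt.1 hcon⟩)

/-- An edge between different components still has uncoloured length, and a pending vertex has time
left. Hence no phase is empty while something is active. -/
theorem wait_pos {s : State V} (h : (G.activeSets t s).Nonempty) : 0 < G.wait t s := by
  rcases G.wait_mem t h with ⟨a, b, hadj, hne, hn, he⟩ | ⟨a, ha, he⟩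
  · rw [he]
    have := G.colored_lt_cost hadj fun h' => hne ((G.component_eq_iff).2 h')
    exact div_pos (by linarith) (by exact_mod_cast hn.card_pos)
  · rw [he]; linarith

theorem wait_eq_zero {s : State V} (h : G.activeSets t s = ∅) : G.wait t s = 0 := by
  have : G.edgeWaits t s ∪ vertexWaits t s = ∅ := by
    rw [Set.eq_empty_iff_forall_notMem]
    rintro δ (⟨a, b, -, -, hn, -⟩ | ⟨a, ha, -⟩)
    · simp [h] at hn
    · have : G.component s a ∈ G.activeSets t s :=
        (G.component_mem_activeSets t).2 ⟨a, SimpleGraph.Reachable.refl _, ha⟩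
      simp [h] at this
  rw [wait, this, Real.sInf_empty]

theorem wait_nonneg (s : State V) : 0 ≤ G.wait t s := by
  rcases (G.activeSets t s).eq_empty_or_nonempty with h | h
  · rw [wait_eq_zero G t h]
  · exact (wait_pos G t h).le

/-- This is how the definition of `wait` is used: no edge can be overfilled within one phase. With
both rates zero the edge does not enter the minimum, and the bound is trivial. -/
theorem mul_rate_le {s : State V} {a b : V} (hadj : G.graph.Adj a b)
    (h : ¬ (G.coloredGraph s).Reachable a b) :
    G.wait t s * (G.rate t s a + G.rate t s b) ≤ G.cost s(a, b) - s.colored a b := by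
  classical
  have hlt := G.colored_lt_cost hadj h
  rw [← card_inter_activeSets G t h]
  rcases (({G.component s a, G.component s b} : Finset (Finset V)) ∩
    G.activeSets t s).eq_empty_or_nonempty with he | hn
  · rw [he]; simp; exact hlt.le
  · have hw := G.wait_le t (s := s)
      (Or.inl ⟨a, b, hadj, fun h' => h ((G.component_eq_iff).1 h'), hn, rfl⟩)
    rwa [le_div_iff₀ (by exact_mod_cast hn.card_pos)] at hw

theorem rate_eq_zero {s : State V} (h : G.activeSets t s = ∅) (a : V) : G.rate t s a = 0 := by
  have : ¬ G.IsActive t s a := by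
    rw [← component_mem_activeSets, h]; simp
  simp [rate, this]

/-- Strictly before the next event no edge between different components fills up. The inequality
must be strict, since merges may occur exactly at the end of the waiting time. -/
theorem reachable_advance_iff {s : State V} {δ : ℝ} (h0 : 0 ≤ δ)
    (hδ : δ < G.wait t s ∨ G.activeSets t s = ∅) {a b : V} :
    (G.coloredGraph (G.advance t s δ)).Reachable a b ↔ (G.coloredGraph s).Reachable a b := by
  refine ⟨SimpleGraph.Reachable.of_adj_reachable fun a b hab => ?_,
    G.reachable_of_colored_le (G.colored_le_colored_advance t s h0)⟩
  by_contra h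
  have h1 := hab.2
  have hlt := G.colored_lt_cost hab.1 h
  rw [colored_advance G t h] at h1
  rcases hδ with hδ | hδ
  · have h2 := G.mul_rate_le t hab.1 h
    rcases (add_nonneg (G.rate_nonneg t s a) (G.rate_nonneg t s b)).eq_or_lt with h3 | h3
    · rw [← h3] at h1; linarith
    · have := mul_lt_mul_of_pos_right hδ h3
      linarith
  · rw [rate_eq_zero G t hδ, rate_eq_zero G t hδ] at h1
    linarith

theorem component_advance {s : State V} {δ : ℝ} (h0 : 0 ≤ δ)
    (hδ : δ < G.wait t s ∨ G.activeSets t s = ∅) (a : V) :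
    G.component (G.advance t s δ) a = G.component s a := by
  ext b
  rw [mem_component, mem_component, reachable_advance_iff G t h0 hδ]

theorem isActive_advance_iff {s : State V} {δ : ℝ} (h0 : 0 ≤ δ)
    (hδ : δ < G.wait t s ∨ G.activeSets t s = ∅) {a : V} :
    G.IsActive t (G.advance t s δ) a ↔ G.IsActive t s a := by
  unfold IsActive
  simp only [reachable_advance_iff G t h0 hδ]
  refine exists_congr fun b => and_congr_right fun hb => ?_
  change s.time + δ < t b ↔ _
  refine ⟨fun h => by linarith, fun h => ?_⟩
  rcases hδ with hδ | hδ
  · have := G.wait_le t (Or.inr ⟨b, h, rfl⟩)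
    linarith
  · have : G.component s b ∈ G.activeSets t s :=
      (G.component_mem_activeSets t).2 ⟨b, SimpleGraph.Reachable.refl _, h⟩
    simp [hδ] at this

theorem activeSets_advance {s : State V} {δ : ℝ} (h0 : 0 ≤ δ)
    (hδ : δ < G.wait t s ∨ G.activeSets t s = ∅) :
    G.activeSets t (G.advance t s δ) = G.activeSets t s := by
  ext S
  simp only [mem_activeSets, component_advance G t h0 hδ, isActive_advance_iff G t h0 hδ]

theorem components_advance {s : State V} {δ : ℝ} (h0 : 0 ≤ δ)
    (hδ : δ < G.wait t s ∨ G.activeSets t s = ∅) :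
    G.components (G.advance t s δ) = G.components s := by
  ext S
  simp only [mem_components, component_advance G t h0 hδ]

/-! ### The run -/

theorem run_succ (n : ℕ) :
    G.run t (n + 1) = G.advance t (G.run t n) (G.wait t (G.run t n)) := rfl

theorem run_succ_time (n : ℕ) :
    (G.run t (n + 1)).time = (G.run t n).time + G.wait t (G.run t n) := rfl

theorem run_succ_of_empty {n : ℕ} (h : G.activeSets t (G.run t n) = ∅) :
    G.run t (n + 1) = G.run t n := by
  rw [run_succ, wait_eq_zero G t h, advance_zero]

theorem run_eq_of_empty {n m : ℕ} (hnm : n ≤ m) (h : G.activeSets t (G.run t n) = ∅) :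
    G.run t m = G.run t n := by
  induction m, hnm using Nat.le_induction with
  | base => rfl
  | succ m _ ih => rw [run_succ_of_empty G t (by rw [ih]; exact h), ih]

theorem run_time_mono : Monotone fun n => (G.run t n).time :=
  monotone_nat_of_le_succ fun n => by
    rw [run_succ_time]
    linarith [G.wait_nonneg t (G.run t n)]

theorem run_time_nonneg (n : ℕ) : 0 ≤ (G.run t n).time :=
  G.run_time_mono t (Nat.zero_le n)

theorem run_growth_nonneg (n : ℕ) (S : Finset V) : 0 ≤ (G.run t n).growth S := by
  induction n with
  | zero => exact le_rfl
  | succ n ih =>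
    rw [run_succ]
    unfold advance
    simp only
    have := G.wait_nonneg t (G.run t n)
    split_ifs <;> linarith

theorem run_colored_mono (a b : V) : Monotone fun n => (G.run t n).colored a b :=
  monotone_nat_of_le_succ fun n => by
    rw [run_succ]
    exact G.colored_le_colored_advance t _ (G.wait_nonneg t _) a b

theorem colored_advance_le_cost {s : State V} {δ : ℝ}
    (hδ : δ ≤ G.wait t s ∨ G.activeSets t s = ∅)
    {a b : V} (hadj : G.graph.Adj a b) (h : s.colored a b ≤ G.cost s(a, b)) :
    (G.advance t s δ).colored a b ≤ G.cost s(a, b) := by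
  by_cases hr : (G.coloredGraph s).Reachable a b
  · rwa [colored_advance_of_reachable G t hr]
  · rw [colored_advance G t hr]
    rcases hδ with hδ | hδ
    · have h1 := G.mul_rate_le t hadj hr
      have h2 := mul_le_mul_of_nonneg_right hδ
        (add_nonneg (G.rate_nonneg t s a) (G.rate_nonneg t s b))
      linarith
    · rw [rate_eq_zero G t hδ, rate_eq_zero G t hδ]
      linarith

theorem run_colored_le_cost (n : ℕ) {a b : V} (hadj : G.graph.Adj a b) :
    (G.run t n).colored a b ≤ G.cost s(a, b) := by
  induction n with
  | zero => simp [run, State.colored]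
  | succ n ih => exact G.colored_advance_le_cost t (Or.inl le_rfl) hadj ih

open scoped Classical in
/-- The progress of the execution: the vertices whose growing time is over, and the pairs of
vertices in a common component. -/
noncomputable def progress (s : State V) : Finset (V ⊕ V × V) :=
  Finset.univ.filter fun x => match x with
    | Sum.inl a => (t a : ℝ) ≤ s.time
    | Sum.inr p => (G.coloredGraph s).Reachable p.1 p.2

-- The next event either fills an edge between two components or ends the time of a vertex. As
-- `progress` lives in a finite type, this forces termination.
open scoped Classical in
theorem progress_ssubset {s : State V} (h : (G.activeSets t s).Nonempty) :
    G.progress t s ⊂ G.progress t (G.step t s) := by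
  have hw := G.wait_nonneg t s
  rw [Finset.ssubset_iff_of_subset]
  · rcases G.wait_mem t h with ⟨a, b, hadj, hne, hn, he⟩ | ⟨a, ha, he⟩
    · have hr : ¬ (G.coloredGraph s).Reachable a b := fun h' => hne ((G.component_eq_iff).2 h')
      refine ⟨Sum.inr (a, b), ?_, by simpa [progress] using hr⟩
      suffices (G.coloredGraph (G.step t s)).Reachable a b by simpa [progress] using this
      refine SimpleGraph.Adj.reachable ⟨hadj, ?_⟩
      rw [step_eq_advance, colored_advance G t hr, ← card_inter_activeSets G t hr, he,
        div_mul_cancel₀]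
      · linarith
      · exact_mod_cast hn.card_pos.ne'
    · refine ⟨Sum.inl a, ?_, by simpa [progress] using ha⟩
      refine Finset.mem_filter.2 ⟨Finset.mem_univ _, ?_⟩
      change (t a : ℝ) ≤ s.time + G.wait t s
      rw [he]; linarith
  · rintro (a | p) hx
    · simp only [progress, Finset.mem_filter, Finset.mem_univ, true_and] at hx ⊢
      change _ ≤ s.time + G.wait t s
      linarith
    · simp only [progress, Finset.mem_filter, Finset.mem_univ, true_and] at hx ⊢
      exact G.reachable_of_colored_le (G.colored_le_colored_advance t s hw) hx

theorem exists_activeSets_run_eq_empty : ∃ n, G.activeSets t (G.run t n) = ∅ := by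
  by_contra! hcon
  have key : ∀ n, n ≤ (G.progress t (G.run t n)).card := by
    intro n
    induction n with
    | zero => exact Nat.zero_le _
    | succ n ih =>
      exact ih.trans_lt (Finset.card_lt_card (G.progress_ssubset t
        (hcon n)))
  have h1 := key (Fintype.card (V ⊕ V × V) + 1)
  have h2 := Finset.card_le_univ (G.progress t (G.run t (Fintype.card (V ⊕ V × V) + 1)))
  omega

/-! ### The execution at real moments -/

theorem exists_inPhase {τ : ℝ} (hτ : 0 ≤ τ) : ∃ n, G.InPhase t n τ := by
  classical
  by_cases h : ∃ n, τ < (G.run t n).time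
  · have h1 := Nat.find_spec h
    have h2 : Nat.find h ≠ 0 := fun h0 => by
      rw [h0] at h1; exact absurd h1 (not_lt.2 hτ)
    obtain ⟨k, hk⟩ := Nat.exists_eq_succ_of_ne_zero h2
    refine ⟨k, not_lt.1 (Nat.find_min h (by omega)), Or.inl ?_⟩
    rwa [hk] at h1
  · push Not at h
    obtain ⟨n, hn⟩ := G.exists_activeSets_run_eq_empty t
    exact ⟨n, h n, Or.inr hn⟩

/-- A phase index is ambiguous only after the process has stopped, and there the run is constant.
This makes `stateAt` independent of the chosen index. -/
theorem InPhase.run_eq_of_le {G : CostGraph V} {t : V → ℝ≥0} {n m : ℕ} {σ τ : ℝ}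
    (hn : G.InPhase t n σ) (hm : G.InPhase t m τ) (hτ : τ ≤ σ) (hnm : n < m) :
    G.run t m = G.run t n := by
  rcases hn.2 with h | h
  · have := G.run_time_mono t (Nat.succ_le_of_lt hnm)
    have h2 := hm.1
    simp only [Nat.succ_eq_add_one] at this
    linarith
  · exact G.run_eq_of_empty t hnm.le h

theorem InPhase.run_eq {G : CostGraph V} {t : V → ℝ≥0} {n m : ℕ} {τ : ℝ}
    (hn : G.InPhase t n τ) (hm : G.InPhase t m τ) : G.run t n = G.run t m := by
  rcases lt_trichotomy n m with h | h | h
  · exact (hn.run_eq_of_le hm le_rfl h).symm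
  · rw [h]
  · exact hm.run_eq_of_le hn le_rfl h

theorem InPhase.nonneg {G : CostGraph V} {t : V → ℝ≥0} {n : ℕ} {τ : ℝ}
    (hn : G.InPhase t n τ) : 0 ≤ τ := (G.run_time_nonneg t n).trans hn.1

theorem InPhase.sub_lt {G : CostGraph V} {t : V → ℝ≥0} {n : ℕ} {τ : ℝ}
    (hn : G.InPhase t n τ) :
    τ - (G.run t n).time < G.wait t (G.run t n) ∨ G.activeSets t (G.run t n) = ∅ := by
  refine hn.2.imp_left fun h => ?_
  rw [run_succ_time] at h
  linarith

open scoped Classical in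
/-- The state at the moment `τ`. -/
noncomputable def stateAt (τ : ℝ) : State V :=
  if h : ∃ n, G.InPhase t n τ then
    G.advance t (G.run t h.choose) (τ - (G.run t h.choose).time)
  -- Only negative moments get here. This default lets `stateAt_time` and `stateAt_growth_nonneg`
  -- hold without a sign condition.
  else ⟨τ, fun _ => 0⟩

theorem InPhase.stateAt_eq {G : CostGraph V} {t : V → ℝ≥0} {n : ℕ} {τ : ℝ}
    (hn : G.InPhase t n τ) :
    G.stateAt t τ = G.advance t (G.run t n) (τ - (G.run t n).time) := by
  have h : ∃ n, G.InPhase t n τ := ⟨n, hn⟩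
  rw [stateAt, dif_pos h, h.choose_spec.run_eq hn]

theorem stateAt_time (τ : ℝ) : (G.stateAt t τ).time = τ := by
  unfold stateAt advance
  split_ifs <;> simp

theorem isComponentAt_iff {τ : ℝ} (hτ : 0 ≤ τ) {S : Finset V} :
    G.IsComponentAt t τ S ↔ S ∈ G.components (G.stateAt t τ) := by
  have key : ∀ n, G.InPhase t n τ →
      G.components (G.stateAt t τ) = G.components (G.run t n) := fun n hn => by
    rw [hn.stateAt_eq, components_advance G t (sub_nonneg.2 hn.1) hn.sub_lt]
  constructor
  · rintro ⟨n, hn, h⟩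
    rwa [key n hn]
  · intro h
    obtain ⟨n, hn⟩ := G.exists_inPhase t hτ
    exact ⟨n, hn, by rwa [← key n hn]⟩

theorem InPhase.activeSets_eq {G : CostGraph V} {t : V → ℝ≥0} {n : ℕ} {τ : ℝ}
    (hn : G.InPhase t n τ) : G.activeSets t (G.stateAt t τ) = G.activeSets t (G.run t n) := by
  rw [hn.stateAt_eq, activeSets_advance G t (sub_nonneg.2 hn.1) hn.sub_lt]

theorem InPhase.component_eq {G : CostGraph V} {t : V → ℝ≥0} {n : ℕ} {τ : ℝ}
    (hn : G.InPhase t n τ) (a : V) :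
    G.component (G.stateAt t τ) a = G.component (G.run t n) a := by
  rw [hn.stateAt_eq, component_advance G t (sub_nonneg.2 hn.1) hn.sub_lt]

theorem growsAt_iff {τ : ℝ} (hτ : 0 ≤ τ) {S : Finset V} :
    G.GrowsAt t τ S ↔ S ∈ G.activeSets t (G.stateAt t τ) := by
  constructor
  · rintro ⟨n, hn, h⟩
    rwa [hn.activeSets_eq]
  · intro h
    obtain ⟨n, hn⟩ := G.exists_inPhase t hτ
    exact ⟨n, hn, by rwa [← hn.activeSets_eq]⟩

/-- `a` and `b` are in the same component at the moment `τ`. -/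
def Joined (τ : ℝ) (a b : V) : Prop := (G.coloredGraph (G.stateAt t τ)).Reachable a b

/-- `a` is in an active set at the moment `τ`. -/
def ActiveAt (τ : ℝ) (a : V) : Prop := G.IsActive t (G.stateAt t τ) a

theorem activeAt_iff {τ : ℝ} {a : V} :
    G.ActiveAt t τ a ↔ ∃ b, G.Joined t τ a b ∧ τ < t b := by
  simp only [ActiveAt, IsActive, Joined, stateAt_time]

theorem Joined.activeAt {G : CostGraph V} {t : V → ℝ≥0} {τ : ℝ} {a b : V}
    (h : G.Joined t τ a b) (hb : G.ActiveAt t τ b) : G.ActiveAt t τ a := by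
  obtain ⟨c, hc, hl⟩ := hb
  exact ⟨c, SimpleGraph.Reachable.trans h hc, hl⟩

/-- The coloured length between `a` and `b` at the moment `τ`. -/
noncomputable def coloredAt (τ : ℝ) (a b : V) : ℝ := (G.stateAt t τ).colored a b

/-- Phases are closed on the left, which gives right-continuity of the component structure. -/
theorem exists_phase_right {τ : ℝ} (hτ : 0 ≤ τ) : ∃ ε > 0, ∀ σ, τ ≤ σ → σ < τ + ε →
    ∃ n, G.InPhase t n τ ∧ G.InPhase t n σ := by
  obtain ⟨n, hn⟩ := G.exists_inPhase t hτ
  rcases hn.2 with h | h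
  · refine ⟨(G.run t (n + 1)).time - τ, by linarith, fun σ h1 h2 => ⟨n, hn, hn.1.trans h1, ?_⟩⟩
    left; linarith
  · exact ⟨1, one_pos, fun σ h1 h2 => ⟨n, hn, hn.1.trans h1, Or.inr h⟩⟩

theorem exists_joined_right {τ : ℝ} (hτ : 0 ≤ τ) : ∃ ε > 0, ∀ σ, τ ≤ σ → σ < τ + ε →
    ∀ a b, G.Joined t σ a b ↔ G.Joined t τ a b := by
  obtain ⟨ε, hε, h⟩ := G.exists_phase_right t hτ
  refine ⟨ε, hε, fun σ h1 h2 a b => ?_⟩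
  obtain ⟨n, hn, hn'⟩ := h σ h1 h2
  simp only [Joined]
  rw [← component_eq_iff, ← component_eq_iff, hn.component_eq, hn.component_eq, hn'.component_eq,
    hn'.component_eq]

theorem InPhase.coloredAt_eq {G : CostGraph V} {t : V → ℝ≥0} {n : ℕ} {τ σ : ℝ}
    (hn : G.InPhase t n τ) (hn' : G.InPhase t n σ) {a b : V} (hab : ¬ G.Joined t τ a b) :
    G.coloredAt t σ a b = G.coloredAt t τ a b +
      (σ - τ) * (G.rate t (G.stateAt t τ) a + G.rate t (G.stateAt t τ) b) := by
  have hr : ¬ (G.coloredGraph (G.run t n)).Reachable a b := by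
    rwa [Joined, ← component_eq_iff, hn.component_eq, hn.component_eq, component_eq_iff] at hab
  have hrate : ∀ c, G.rate t (G.stateAt t τ) c = G.rate t (G.run t n) c := fun c => by
    have : G.IsActive t (G.stateAt t τ) c ↔ G.IsActive t (G.run t n) c := by
      rw [← component_mem_activeSets, ← component_mem_activeSets, hn.activeSets_eq,
        hn.component_eq]
    classical exact if_congr this rfl rfl
  rw [coloredAt, coloredAt, hrate, hrate, hn.stateAt_eq, hn'.stateAt_eq, colored_advance G t hr,
    colored_advance G t hr]
  ring

theorem exists_colored_right {τ : ℝ} (hτ : 0 ≤ τ) : ∃ ε > 0, ∀ σ, τ ≤ σ → σ < τ + ε →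
    ∀ a b, ¬ G.Joined t τ a b → G.coloredAt t σ a b = G.coloredAt t τ a b +
      (σ - τ) * (G.rate t (G.stateAt t τ) a + G.rate t (G.stateAt t τ) b) := by
  obtain ⟨ε, hε, h⟩ := G.exists_phase_right t hτ
  refine ⟨ε, hε, fun σ h1 h2 a b hab => ?_⟩
  obtain ⟨n, hn, hn'⟩ := h σ h1 h2
  exact hn.coloredAt_eq hn' hab

theorem coloredAt_mono {σ τ : ℝ} (hσ : 0 ≤ σ) (h : σ ≤ τ) (a b : V) :
    G.coloredAt t σ a b ≤ G.coloredAt t τ a b := by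
  obtain ⟨n, hn⟩ := G.exists_inPhase t hσ
  obtain ⟨m, hm⟩ := G.exists_inPhase t (hσ.trans h)
  have key : ∀ k, G.InPhase t k σ → G.InPhase t k τ →
      G.coloredAt t σ a b ≤ G.coloredAt t τ a b := fun k h1 h2 => by
    by_cases hab : G.Joined t σ a b
    · have hr : (G.coloredGraph (G.run t k)).Reachable a b := by
        rwa [Joined, ← component_eq_iff, h1.component_eq, h1.component_eq, component_eq_iff] at hab
      rw [coloredAt, coloredAt, h1.stateAt_eq, h2.stateAt_eq,
        colored_advance_of_reachable G t hr, colored_advance_of_reachable G t hr]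
    · rw [h1.coloredAt_eq h2 hab]
      have := mul_nonneg (sub_nonneg.2 h) (add_nonneg (G.rate_nonneg t (G.stateAt t σ) a)
        (G.rate_nonneg t (G.stateAt t σ) b))
      linarith
  rcases lt_or_ge n m with hlt | hge
  · rcases hn.2 with h1 | h1
    · calc G.coloredAt t σ a b
          ≤ (G.run t (n + 1)).colored a b := by
            rw [coloredAt, hn.stateAt_eq, run_succ]
            by_cases hr : (G.coloredGraph (G.run t n)).Reachable a b
            · rw [colored_advance_of_reachable G t hr, colored_advance_of_reachable G t hr]
            · rw [colored_advance G t hr, colored_advance G t hr]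
              rw [run_succ_time] at h1
              have := mul_le_mul_of_nonneg_right
                (show σ - (G.run t n).time ≤ G.wait t (G.run t n) by linarith)
                (add_nonneg (G.rate_nonneg t (G.run t n) a) (G.rate_nonneg t (G.run t n) b))
              linarith
        _ ≤ (G.run t m).colored a b := G.run_colored_mono t a b (Nat.succ_le_of_lt hlt)
        _ ≤ G.coloredAt t τ a b := by
            rw [coloredAt, hm.stateAt_eq]
            exact G.colored_le_colored_advance t _ (sub_nonneg.2 hm.1) a b
    · exact key n hn ⟨hn.1.trans h, Or.inr h1⟩
  -- The earlier moment can have the larger index only once the run is stationary.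
  · rcases hge.lt_or_eq with hlt | rfl
    · have e := hm.run_eq_of_le hn h hlt
      refine key n hn ⟨?_, ?_⟩
      · rw [e]; exact hm.1
      · rcases hm.2 with h2 | h2
        · have := G.run_time_mono t (Nat.succ_le_of_lt hlt)
          have h3 := hn.1
          simp only [Nat.succ_eq_add_one] at this
          linarith
        · right; rwa [e]
    · exact key _ hn hm

theorem Joined.mono {G : CostGraph V} {t : V → ℝ≥0} {σ τ : ℝ} {a b : V}
    (hab : G.Joined t σ a b) (hσ : 0 ≤ σ) (h : σ ≤ τ) : G.Joined t τ a b :=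
  G.reachable_of_colored_le (G.coloredAt_mono t hσ h) hab

/-- The phase before a moment. -/
theorem exists_phase_left {τ : ℝ} (hτ : 0 < τ) : ∃ n, (G.run t n).time < τ ∧
    (τ ≤ (G.run t (n + 1)).time ∨ G.activeSets t (G.run t n) = ∅) := by
  classical
  by_cases h : ∃ n, τ ≤ (G.run t n).time
  · have h1 := Nat.find_spec h
    have h2 : Nat.find h ≠ 0 := fun h0 => by
      rw [h0] at h1; exact absurd h1 (not_le.2 hτ)
    obtain ⟨k, hk⟩ := Nat.exists_eq_succ_of_ne_zero h2
    refine ⟨k, not_le.1 (Nat.find_min h (by omega)), Or.inl ?_⟩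
    rwa [hk] at h1
  · push Not at h
    obtain ⟨n, hn⟩ := G.exists_activeSets_run_eq_empty t
    exact ⟨n, h n, Or.inr hn⟩

/-- The right endpoint of a phase is included: growth is continuous, so the state that ends one
phase is the state that starts the next. Left limits rely on this. -/
theorem stateAt_eq_advance {n : ℕ} {τ : ℝ} (h1 : (G.run t n).time ≤ τ)
    (h2 : τ ≤ (G.run t (n + 1)).time ∨ G.activeSets t (G.run t n) = ∅) :
    G.stateAt t τ = G.advance t (G.run t n) (τ - (G.run t n).time) := by
  by_cases h : G.InPhase t n τ
  · exact h.stateAt_eq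
  · have h3 : τ = (G.run t (n + 1)).time := by
      simp only [InPhase, not_and_or, not_or, not_lt] at h
      rcases h with h | ⟨h, h'⟩
      · exact absurd h1 h
      · rcases h2 with h2 | h2
        · exact le_antisymm h2 h
        · exact absurd h2 h'
    have h4 : G.InPhase t (n + 1) τ := by
      refine ⟨h3.ge, ?_⟩
      rcases (G.activeSets t (G.run t (n + 1))).eq_empty_or_nonempty with h5 | h5
      · exact Or.inr h5
      · left
        rw [run_succ_time, h3]
        linarith [G.wait_pos t h5]
    rw [h4.stateAt_eq, h3, sub_self, advance_zero, run_succ_time, run_succ, add_sub_cancel_left]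

/-- On the closed phase ending at or beyond `τ` the coloured length is affine in time, so the bound
passes to the left limit. -/
theorem coloredAt_le_of_forall_lt {τ c : ℝ} (hτ : 0 < τ) {a b : V}
    (h : ∀ σ, 0 ≤ σ → σ < τ → G.coloredAt t σ a b ≤ c) : G.coloredAt t τ a b ≤ c := by
  obtain ⟨n, hn, hn'⟩ := G.exists_phase_left t hτ
  have h0 := G.run_time_nonneg t n
  have e : ∀ σ, (G.run t n).time ≤ σ → σ ≤ τ →
      G.stateAt t σ = G.advance t (G.run t n) (σ - (G.run t n).time) := fun σ h1 h2 =>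
    G.stateAt_eq_advance t h1 (hn'.imp_left h2.trans)
  by_cases hr : (G.coloredGraph (G.run t n)).Reachable a b
  · have := h _ h0 hn
    rw [coloredAt, e _ le_rfl hn.le, colored_advance_of_reachable G t hr] at this
    rwa [coloredAt, e _ hn.le le_rfl, colored_advance_of_reachable G t hr]
  · rw [coloredAt, e _ hn.le le_rfl, colored_advance G t hr]
    set r := G.rate t (G.run t n) a + G.rate t (G.run t n) b with hrdef
    have hc : Filter.Tendsto
        (fun σ => (G.run t n).colored a b + (σ - (G.run t n).time) * r)
        (nhdsWithin τ (Set.Iio τ))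
        (nhds ((G.run t n).colored a b + (τ - (G.run t n).time) * r)) :=
      (Continuous.tendsto (by fun_prop) τ).mono_left nhdsWithin_le_nhds
    refine le_of_tendsto hc ?_
    filter_upwards [Ioo_mem_nhdsLT hn] with σ hσ
    have := h σ (h0.trans hσ.1.le) hσ.2
    rwa [coloredAt, e _ hσ.1.le hσ.2.le, colored_advance G t hr] at this

theorem coloredAt_le_cost {τ : ℝ} (hτ : 0 ≤ τ) {a b : V} (hadj : G.graph.Adj a b) :
    G.coloredAt t τ a b ≤ G.cost s(a, b) := by
  obtain ⟨n, hn⟩ := G.exists_inPhase t hτ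
  rw [coloredAt, hn.stateAt_eq]
  exact G.colored_advance_le_cost t (hn.sub_lt.imp_left le_of_lt) hadj
    (G.run_colored_le_cost t n hadj)

theorem stateAt_growth_nonneg (τ : ℝ) (S : Finset V) : 0 ≤ (G.stateAt t τ).growth S := by
  by_cases h : ∃ n, G.InPhase t n τ
  · obtain ⟨n, hn⟩ := h
    rw [hn.stateAt_eq]
    unfold advance
    simp only
    have h1 := G.run_growth_nonneg t n S
    have h2 := hn.1
    split_ifs <;> linarith
  · rw [stateAt, dif_neg h]

end CostGraph

/-! ### First moments, monotonicity of executions, coloured length against distance -/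

/-- The first moment up to `M` at which a right-continuous property holds. -/
theorem exists_first_moment {P : ℝ → Prop} {M : ℝ} (hM : 0 ≤ M)
    (hP : ∀ τ, 0 ≤ τ → ∃ ε > 0, ∀ σ, τ ≤ σ → σ < τ + ε → P σ → P τ) :
    ∃ r, 0 ≤ r ∧ r ≤ M ∧ (∀ τ, 0 ≤ τ → τ < r → ¬ P τ) ∧ (r < M → P r) := by
  by_cases h : ∃ τ, 0 ≤ τ ∧ τ < M ∧ P τ
  · set B : Set ℝ := {τ | 0 ≤ τ ∧ τ < M ∧ P τ} with hB
    have hne : B.Nonempty := h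
    have hbd : BddBelow B := ⟨0, fun x hx => hx.1⟩
    have h0 : 0 ≤ sInf B := le_csInf hne fun x hx => hx.1
    have hle : sInf B ≤ M := by
      obtain ⟨x, hx⟩ := h
      exact (csInf_le hbd hx).trans hx.2.1.le
    refine ⟨sInf B, h0, hle, fun τ h1 h2 h3 => ?_, fun _ => ?_⟩
    · exact absurd (csInf_le hbd ⟨h1, h2.trans_le hle, h3⟩) (not_le.2 h2)
    · obtain ⟨ε, hε, hr⟩ := hP _ h0
      obtain ⟨x, hx, hxl⟩ := exists_lt_of_csInf_lt hne (lt_add_of_pos_right (sInf B) hε)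
      exact hr x (csInf_le hbd hx) hxl hx.2.2
  · push Not at h
    -- If `P` fails throughout `[0, M)`, the cap `M` is returned and nothing is claimed about `P M`.
    exact ⟨M, hM, le_rfl, h, fun h' => absurd h' (lt_irrefl _)⟩

namespace CostGraph

theorem boost_self {V : Type*} (t : V → ℝ≥0) (q : V) (σ : ℝ≥0) : boost t q σ q = σ := by simp [boost]

theorem boost_of_ne {V : Type*} (t : V → ℝ≥0) {a q : V} (h : a ≠ q) (σ : ℝ≥0) :
    boost t q σ a = t a := by simp [boost, h]

section State

variable {V : Type*} [Fintype V]

theorem State.colored_self (s : State V) (a : V) : s.colored a a = 0 := by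
  classical
  unfold State.colored
  refine Finset.sum_eq_zero fun S hS => ?_
  have := (Finset.mem_filter.1 hS).2
  tauto

/-- A set separating `a` from `c` separates `a` from `b` or `b` from `c`. -/
theorem State.colored_triangle {s : State V} (hs : ∀ S, 0 ≤ s.growth S) (a b c : V) :
    s.colored a c ≤ s.colored a b + s.colored b c := by
  classical
  unfold State.colored
  rw [Finset.sum_filter, Finset.sum_filter, Finset.sum_filter, ← Finset.sum_add_distrib]
  refine Finset.sum_le_sum fun S _ => ?_
  have := hs S
  by_cases ha : a ∈ S <;> by_cases hb : b ∈ S <;> by_cases hc : c ∈ S <;> simp [ha, hb, hc, this]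

end State

variable {V : Type*} [Fintype V] (G : CostGraph V) (t : V → ℝ≥0)

theorem stateAt_zero : G.stateAt t 0 = ⟨0, fun _ => 0⟩ := by
  have h := G.stateAt_eq_advance t (n := 0) (τ := 0) le_rfl (Or.inl (G.run_time_nonneg t _))
  rw [h]
  change G.advance t (G.run t 0) (0 - 0) = _
  rw [sub_self, advance_zero]
  rfl

theorem rate_le_one (s : State V) (a : V) : G.rate t s a ≤ 1 := by
  unfold rate; split_ifs <;> norm_num

theorem rate_eq_one {s : State V} {a : V} (h : G.IsActive t s a) : G.rate t s a = 1 := by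
  simp [rate, h]

/-- Executions are monotone: if up to `M` every vertex that keeps its set active in the first
execution is in an active set of the second execution, then the components of the second execution
are coarser. -/
theorem joined_of_joined {t₁ t₂ : V → ℝ≥0} {M : ℝ}
    (h : ∀ τ a, 0 ≤ τ → τ < M → τ < t₁ a → G.ActiveAt t₂ τ a) {τ : ℝ} (h0 : 0 ≤ τ) (hM : τ ≤ M)
    {a b : V} (hab : G.Joined t₁ τ a b) : G.Joined t₂ τ a b := by
  have lift : ∀ τ, (∀ a b, G.Joined t₂ τ a b ∨ G.coloredAt t₁ τ a b ≤ G.coloredAt t₂ τ a b) →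
      ∀ a b, G.Joined t₁ τ a b → G.Joined t₂ τ a b := fun τ hτ a b hab =>
    hab.of_adj_reachable (K := G.coloredGraph (G.stateAt t₂ τ)) fun a b hadj => by
      rcases hτ a b with h1 | h1
      · exact h1
      · exact SimpleGraph.Adj.reachable ⟨hadj.1, hadj.2.trans h1⟩
  -- The alternative is needed: once a pair is joined in the second execution its coloured length
  -- stops growing there, and the first may overtake. While it is not joined, the rates in the
  -- second execution dominate, since its components are coarser.
  have key : ∀ τ, 0 ≤ τ → τ ≤ M → ∀ a b,
      G.Joined t₂ τ a b ∨ G.coloredAt t₁ τ a b ≤ G.coloredAt t₂ τ a b := by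
    refine nonneg_real_induction ?_ ?_ ?_
    · intro _ a b
      right
      rw [coloredAt, coloredAt, stateAt_zero, stateAt_zero]
    · intro τ hτ ih
      obtain ⟨ε₁, hε₁, h₁⟩ := G.exists_colored_right t₁ hτ
      obtain ⟨ε₂, hε₂, h₂⟩ := G.exists_colored_right t₂ hτ
      refine ⟨min ε₁ ε₂, lt_min hε₁ hε₂, fun σ hσ1 hσ2 hσM a b => ?_⟩
      rcases hσ1.eq_or_lt with rfl | hlt
      · exact ih hσM a b
      have hτM := ih (hσ1.trans hσM)
      by_cases hj : G.Joined t₂ τ a b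
      · exact Or.inl (hj.mono hτ hσ1)
      right
      have hc := (hτM a b).resolve_left hj
      rw [h₁ σ hσ1 (hσ2.trans_le (by gcongr; exact min_le_left _ _)) a b
        (fun h' => hj (lift τ hτM a b h')),
        h₂ σ hσ1 (hσ2.trans_le (by gcongr; exact min_le_right _ _)) a b hj]
      have hrate : ∀ c, G.rate t₁ (G.stateAt t₁ τ) c ≤ G.rate t₂ (G.stateAt t₂ τ) c := by
        intro c
        by_cases hact : G.ActiveAt t₁ τ c
        · obtain ⟨d, hd, hl⟩ := (G.activeAt_iff t₁).1 hact
          rw [G.rate_eq_one t₂ ((lift τ hτM c d hd).activeAt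
            (h τ d hτ (hlt.trans_le hσM) hl))]
          exact G.rate_le_one _ _ _
        · have : G.rate t₁ (G.stateAt t₁ τ) c = 0 := if_neg hact
          rw [this]
          exact G.rate_nonneg _ _ _
      have := mul_le_mul_of_nonneg_left (add_le_add (hrate a) (hrate b)) (sub_nonneg.2 hσ1)
      linarith
    · intro τ hτ ih hτM a b
      by_cases hj : G.Joined t₂ τ a b
      · exact Or.inl hj
      right
      refine G.coloredAt_le_of_forall_lt t₁ hτ fun σ h1 h2 => ?_
      have hσ := (ih σ h1 h2 (h2.le.trans hτM) a b).resolve_left fun h' => hj (h'.mono h1 h2.le)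
      exact hσ.trans (G.coloredAt_mono t₂ h1 h2.le a b)
  exact lift τ (key τ h0 hM) a b hab

/-- Two vertices in different active sets colour the paths between them from both sides. -/
theorem two_mul_le_coloredAt {r : ℝ} (hr : 0 ≤ r) {a b : V}
    (h : ∀ τ, 0 ≤ τ → τ < r → ¬ G.Joined t τ a b ∧ G.ActiveAt t τ a ∧ G.ActiveAt t τ b) :
    2 * r ≤ G.coloredAt t r a b := by
  have key : ∀ τ, 0 ≤ τ → τ ≤ r → 2 * τ ≤ G.coloredAt t τ a b := by
    refine nonneg_real_induction ?_ ?_ ?_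
    · intro _
      rw [coloredAt, stateAt_zero]
      simp [State.colored]
    · intro τ hτ ih
      obtain ⟨ε, hε, h₁⟩ := G.exists_colored_right t hτ
      refine ⟨ε, hε, fun σ hσ1 hσ2 hσr => ?_⟩
      rcases hσ1.eq_or_lt with rfl | hlt
      · exact ih hσr
      obtain ⟨hj, ha, hb⟩ := h τ hτ (hlt.trans_le hσr)
      rw [h₁ σ hσ1 hσ2 a b hj, G.rate_eq_one t ha, G.rate_eq_one t hb]
      linarith [ih (hσ1.trans hσr)]
    · intro τ hτ ih hτr
      by_contra! hcon
      set c := G.coloredAt t τ a b with hc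
      -- If `c < 2 * τ`, a moment `σ < τ` with `2 * σ > c` contradicts monotonicity of the coloured
      -- length.
      have hσ : max 0 (c / 2) < τ := max_lt hτ (by linarith)
      set σ := (max 0 (c / 2) + τ) / 2 with hσdef
      have h1 : 0 ≤ max 0 (c / 2) := le_max_left _ _
      have h2 : c / 2 ≤ max 0 (c / 2) := le_max_right _ _
      have h3 := ih σ (by linarith) (by linarith) (by linarith)
      have h4 := G.coloredAt_mono t (σ := σ) (τ := τ) (by linarith) (by linarith) a b
      linarith
  exact key r hr le_rfl

/-- `colored` makes sense for non-adjacent pairs too; the triangle inequality and the cost bound on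
each edge turn it into a lower bound for path lengths. -/
theorem coloredAt_le_walkCost {τ : ℝ} (hτ : 0 ≤ τ) {a b : V} (p : G.graph.Walk a b) :
    G.coloredAt t τ a b ≤ G.walkCost p := by
  induction p with
  | nil => simp [coloredAt, State.colored_self]
  | @cons a b c hadj p ih =>
    have h1 := State.colored_triangle (G.stateAt_growth_nonneg t τ) a b c
    have h2 := G.coloredAt_le_cost t hτ hadj
    simp only [walkCost, SimpleGraph.Walk.edges_cons, List.map_cons, List.sum_cons,
      NNReal.coe_add] at ih ⊢
    simp only [coloredAt] at *
    linarith

theorem ofReal_coloredAt_le_dist {τ : ℝ} (hτ : 0 ≤ τ) (a b : V) :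
    ENNReal.ofReal (G.coloredAt t τ a b) ≤ G.dist a b :=
  le_iInf fun p => by
    rw [← ENNReal.ofReal_coe_nnreal]
    exact ENNReal.ofReal_le_ofReal (G.coloredAt_le_walkCost t hτ p)

theorem ofReal_le_dist_div_two {r : ℝ} (hr : 0 ≤ r) {a b : V}
    (h : ∀ τ, 0 ≤ τ → τ < r → ¬ G.Joined t τ a b ∧ G.ActiveAt t τ a ∧ G.ActiveAt t τ b) :
    ENNReal.ofReal r ≤ G.dist a b / 2 := by
  rw [ENNReal.le_div_iff_mul_le (by simp) (by simp), mul_comm,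
    show (2 : ℝ≥0∞) = ENNReal.ofReal 2 by simp, ← ENNReal.ofReal_mul zero_le_two]
  exact (ENNReal.ofReal_le_ofReal (G.two_mul_le_coloredAt t hr h)).trans
    (G.ofReal_coloredAt_le_dist t hr a b)

/-- The merging sets are the components of `q` and `u` in the phase that precedes `σ`. This produces
the data required by `IsCandidate`. -/
theorem exists_merge {σ : ℝ} (hσ : 0 < σ) {q u : V}
    (h : ∀ τ, 0 ≤ τ → τ < σ → ¬ G.Joined t τ q u ∧ G.ActiveAt t τ q ∧ G.ActiveAt t τ u)
    (hj : G.Joined t σ q u) :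
    ∃ S S' C : Finset V, q ∈ S ∧ S ≠ S' ∧ G.GrowsUntil t σ S ∧ G.GrowsUntil t σ S' ∧
      G.IsComponentAt t σ C ∧ S ⊆ C ∧ S' ⊆ C := by
  obtain ⟨n, hn, hn'⟩ := G.exists_phase_left t hσ
  have h0 := G.run_time_nonneg t n
  have hph : G.InPhase t n (G.run t n).time := ⟨le_rfl, hn'.imp_left hn.trans_le⟩
  obtain ⟨h1, h2, h3⟩ := h _ h0 hn
  have hmem : ∀ c, G.ActiveAt t (G.run t n).time c →
      G.component (G.stateAt t (G.run t n).time) c ∈ G.activeSets t (G.run t n) := fun c hc => by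
    rw [← hph.activeSets_eq]
    exact (G.component_mem_activeSets t).2 hc
  have hle : σ ≤ (G.run t (n + 1)).time := by
    rcases hn' with h' | h'
    · exact h'
    · have := hmem q h2
      simp [h'] at this
  refine ⟨G.component (G.stateAt t (G.run t n).time) q,
    G.component (G.stateAt t (G.run t n).time) u, G.component (G.stateAt t σ) q,
    G.self_mem_component _ _, fun h' => h1 ((G.component_eq_iff).1 h'), ⟨n, hn, hle, hmem q h2⟩,
    ⟨n, hn, hle, hmem u h3⟩, (G.isComponentAt_iff t hσ.le).2 ((G.mem_components).2 ⟨q, rfl⟩),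
    fun b hb => ?_, fun b hb => ?_⟩
  · exact (G.mem_component).2 (Joined.mono ((G.mem_component).1 hb) h0 hn.le)
  · exact (G.mem_component).2
      (SimpleGraph.Reachable.trans hj (Joined.mono ((G.mem_component).1 hb) h0 hn.le))

end CostGraph

/-! ### Weighted growth as an integral over time -/

namespace CostGraph

variable {V : Type*} [Fintype V] (G : CostGraph V) (t : V → ℝ≥0)

open scoped Classical in
/-- The weight of an active set at the moment `τ`: base growth counts once, additional growth
`1 + β` times. -/
noncomputable def weight {V : Type*} (t : V → ℝ≥0) (β τ : ℝ) (S : Finset V) : ℝ :=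
  if ∃ a ∈ S, τ < t a then 1 else 1 + β

/-- The total weight of the active sets at the moment `τ` in the execution with fingerprint `s`. -/
noncomputable def totalWeight (β : ℝ) (s : V → ℝ≥0) (τ : ℝ) : ℝ :=
  ∑ S ∈ G.activeSets s (G.stateAt s τ), weight t β τ S

section Integral

open MeasureTheory

theorem measurableSet_growsAt (S : Finset V) : MeasurableSet {τ : ℝ | G.GrowsAt t τ S} := by
  have : {τ : ℝ | G.GrowsAt t τ S} = ⋃ n, (Set.Ici (G.run t n).time ∩
      (Set.Iio (G.run t (n + 1)).time ∪ {_τ | G.activeSets t (G.run t n) = ∅})) ∩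
      {_τ | S ∈ G.activeSets t (G.run t n)} := by
    ext τ
    simp [GrowsAt, InPhase]
  rw [this]
  exact MeasurableSet.iUnion fun n => ((measurableSet_Ici.inter
    (measurableSet_Iio.union (MeasurableSet.const _))).inter (MeasurableSet.const _))

theorem GrowsAt.nonneg {G : CostGraph V} {t : V → ℝ≥0} {τ : ℝ} {S : Finset V}
    (h : G.GrowsAt t τ S) : 0 ≤ τ := by
  obtain ⟨n, hn, -⟩ := h
  exact hn.nonneg

theorem GrowsAt.exists_lt {G : CostGraph V} {t : V → ℝ≥0} {τ : ℝ} {S : Finset V}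
    (h : G.GrowsAt t τ S) : ∃ a ∈ S, τ < t a := by
  obtain ⟨a, rfl, b, hb, hl⟩ := (G.mem_activeSets t).1 ((G.growsAt_iff t h.nonneg).1 h)
  rw [stateAt_time] at hl
  exact ⟨b, (G.mem_component).2 hb, hl⟩

/-- An active set contains a vertex whose time is not over, so growth is confined to a bounded
interval. Finiteness matters because `volume.real` would turn an infinite measure into `0`. -/
theorem measure_growsAt_ne_top {S : Finset V} {B : Set ℝ} (hB : B ⊆ {τ | G.GrowsAt t τ S}) :
    volume B ≠ ⊤ := by
  have hsub : B ⊆ Set.Icc (0 : ℝ) (∑ a, (t a : ℝ)) := fun τ hτ => by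
    have h := hB hτ
    obtain ⟨a, -, hl⟩ := h.exists_lt
    exact ⟨h.nonneg, hl.le.trans (Finset.single_le_sum (f := fun a => (t a : ℝ))
      (fun a _ => (t a).coe_nonneg) (Finset.mem_univ a))⟩
  exact ((measure_mono hsub).trans_lt (by simp)).ne

theorem measurableSet_base {V : Type*} (t : V → ℝ≥0) (S : Finset V) : MeasurableSet {τ : ℝ | ∃ a ∈ S, τ < t a} := by
  have : {τ : ℝ | ∃ a ∈ S, τ < t a} = ⋃ a ∈ S, Set.Iio (t a : ℝ) := by
    ext τ; simp
  rw [this]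
  exact Finset.measurableSet_biUnion _ fun a _ => measurableSet_Iio

theorem integrable_indicator_one {B : Set ℝ} (hB : MeasurableSet B) (h : volume B ≠ ⊤) :
    Integrable (B.indicator (1 : ℝ → ℝ)) := by
  rw [integrable_indicator_iff hB]
  exact integrableOn_const h

/-- The total weight, as a function on the real line. -/
noncomputable def weightFun (β : ℝ) (s : V → ℝ≥0) (τ : ℝ) : ℝ :=
  ∑ S : Finset V, ({τ : ℝ | G.GrowsAt s τ S ∧ ∃ a ∈ S, τ < t a}.indicator 1 τ +
    (1 + β) * {τ : ℝ | G.GrowsAt s τ S ∧ ∀ a ∈ S, t a ≤ τ}.indicator 1 τ)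

theorem weightFun_of_neg (β : ℝ) (s : V → ℝ≥0) {τ : ℝ} (hτ : τ < 0) :
    G.weightFun t β s τ = 0 := by
  have h : ∀ S, ¬ G.GrowsAt s τ S := fun S hS => absurd hS.nonneg (not_le.2 hτ)
  simp [weightFun, h]

theorem weightFun_of_nonneg (β : ℝ) (s : V → ℝ≥0) {τ : ℝ} (hτ : 0 ≤ τ) :
    G.weightFun t β s τ = G.totalWeight t β s τ := by
  classical
  have e : G.activeSets s (G.stateAt s τ) = Finset.univ.filter fun S => G.GrowsAt s τ S := by
    ext S
    simp [G.growsAt_iff s hτ]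
  rw [weightFun, totalWeight, e, Finset.sum_filter]
  refine Finset.sum_congr rfl fun S _ => ?_
  by_cases h1 : G.GrowsAt s τ S
  · by_cases h2 : ∃ a ∈ S, τ < t a
    · have h3 : ¬ ∀ a ∈ S, (t a : ℝ) ≤ τ := by push Not; exact h2
      simp only [Set.indicator, Set.mem_ofPred_eq, h1, h2, h3, weight]
      simp
    · have h3 : ∀ a ∈ S, (t a : ℝ) ≤ τ := by push Not at h2; exact h2
      simp only [Set.indicator, Set.mem_ofPred_eq, h1, h2, weight, if_true, true_and, if_false]
      rw [if_pos h3]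
      simp
  · simp [Set.indicator, h1]

theorem measurableSet_base_growsAt (s : V → ℝ≥0) (S : Finset V) :
    MeasurableSet {τ : ℝ | G.GrowsAt s τ S ∧ ∃ a ∈ S, τ < t a} :=
  (G.measurableSet_growsAt s S).inter (measurableSet_base t S)

theorem measurableSet_additional_growsAt (s : V → ℝ≥0) (S : Finset V) :
    MeasurableSet {τ : ℝ | G.GrowsAt s τ S ∧ ∀ a ∈ S, t a ≤ τ} := by
  have : {τ : ℝ | G.GrowsAt s τ S ∧ ∀ a ∈ S, t a ≤ τ} =
      {τ : ℝ | G.GrowsAt s τ S} ∩ {τ : ℝ | ∃ a ∈ S, τ < t a}ᶜ := by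
    ext τ; simp
  rw [this]
  exact (G.measurableSet_growsAt s S).inter (measurableSet_base t S).compl

theorem integrable_weightFun_summand (β : ℝ) (s : V → ℝ≥0) (S : Finset V) :
    Integrable fun τ : ℝ => ({τ : ℝ | G.GrowsAt s τ S ∧ ∃ a ∈ S, τ < t a}.indicator 1 τ +
    (1 + β) * {τ : ℝ | G.GrowsAt s τ S ∧ ∀ a ∈ S, t a ≤ τ}.indicator 1 τ) :=
  (integrable_indicator_one (G.measurableSet_base_growsAt t s S)
    (G.measure_growsAt_ne_top s fun _ h => h.1)).add
  ((integrable_indicator_one (G.measurableSet_additional_growsAt t s S)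
    (G.measure_growsAt_ne_top s fun _ h => h.1)).const_mul _)

theorem integrable_weightFun (β : ℝ) (s : V → ℝ≥0) : Integrable (G.weightFun t β s) :=
  integrable_finsetSum _ fun S _ => G.integrable_weightFun_summand t β s S

/-- Valuability thus says that this integral does not increase, which can be checked moment by
moment. -/
theorem integral_weightFun (β : ℝ) (s : V → ℝ≥0) :
    ∫ τ, G.weightFun t β s τ = G.yBase t s + (1 + β) * G.yAdd t s := by
  unfold weightFun
  rw [integral_finsetSum _ fun S _ => G.integrable_weightFun_summand t β s S, yBase, yAdd,
    Finset.mul_sum, ← Finset.sum_add_distrib]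
  refine Finset.sum_congr rfl fun S _ => ?_
  rw [integral_add (integrable_indicator_one (G.measurableSet_base_growsAt t s S)
    (G.measure_growsAt_ne_top s fun _ h => h.1))
    ((integrable_indicator_one (G.measurableSet_additional_growsAt t s S)
    (G.measure_growsAt_ne_top s fun _ h => h.1)).const_mul _), integral_const_mul,
    integral_indicator_one (G.measurableSet_base_growsAt t s S),
    integral_indicator_one (G.measurableSet_additional_growsAt t s S)]

end Integral

theorem one_le_weight {V : Type*} (t : V → ℝ≥0) {β : ℝ} (hβ : 0 ≤ β) (τ : ℝ) (S : Finset V) :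
    1 ≤ weight t β τ S := by
  unfold weight; split_ifs <;> linarith

theorem weight_le {V : Type*} (t : V → ℝ≥0) {β : ℝ} (hβ : 0 ≤ β) (τ : ℝ) (S : Finset V) :
    weight t β τ S ≤ 1 + β := by
  unfold weight; split_ifs <;> linarith

/-- Enlarging a set can turn additional growth into base growth, never the reverse. -/
theorem weight_anti {V : Type*} (t : V → ℝ≥0) {β : ℝ} (hβ : 0 ≤ β) (τ : ℝ) {S C : Finset V}
    (h : S ⊆ C) : weight t β τ C ≤ weight t β τ S := by
  by_cases hS : ∃ a ∈ S, τ < t a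
  · have hC : ∃ a ∈ C, τ < t a := hS.imp fun a ha => ⟨h ha.1, ha.2⟩
    rw [weight, weight, if_pos hS, if_pos hC]
  · rw [weight, weight, if_neg hS]
    split_ifs <;> linarith

open scoped Classical in
/-- Sets that merge in the coarser execution reduce the total weight; only the set of the boosted
vertex `q` can increase it. -/
theorem totalWeight_add_le {s s' : V → ℝ≥0} {β τ : ℝ} (hβ : 0 ≤ β) {q : V}
    (hJ : ∀ a b, G.Joined s τ a b → G.Joined s' τ a b)
    (hs : ∀ a, a ≠ q → τ < s' a → τ < s a)
    (X : Finset V) (hX : ∀ x ∈ X, G.ActiveAt s τ x) {g : ℕ}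
    (hg : (X.image (G.component (G.stateAt s' τ))).card + g ≤
      (X.image (G.component (G.stateAt s τ))).card) :
    G.totalWeight t β s' τ + g ≤
      G.totalWeight t β s τ + if τ < s' q then 1 + β else 0 := by
  set A := G.activeSets s (G.stateAt s τ) with hA
  set A' := G.activeSets s' (G.stateAt s' τ) with hA'
  set c := G.component (G.stateAt s τ) with hc
  set c' := G.component (G.stateAt s' τ) with hc'
  -- On a component of the finer execution, `f` gives the component of the coarser one that contains
  -- it.
  set f : Finset V → Finset V := fun S => S.biUnion c' with hf
  have hfc : ∀ a, f (c a) = c' a := by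
    intro a
    ext b
    simp only [hf, hc, hc', Finset.mem_biUnion, mem_component]
    constructor
    · rintro ⟨d, hd, hb⟩
      exact SimpleGraph.Reachable.trans (hJ a d hd) hb
    · exact fun h => ⟨a, SimpleGraph.Reachable.refl _, h⟩
  have hsub : ∀ S, S ⊆ f S := fun S a ha =>
    Finset.mem_biUnion.2 ⟨a, ha, G.self_mem_component _ _⟩
  -- An active set of `s'` that absorbs no active set of `s` can be kept active by `q` alone.
  have hnew : A' \ A.image f ⊆ if τ < s' q then {c' q} else ∅ := by
    intro C hC
    rw [Finset.mem_sdiff] at hC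
    obtain ⟨a, rfl, ha⟩ := (G.mem_activeSets s').1 hC.1
    obtain ⟨b, hab, hb⟩ := (G.activeAt_iff s').1 ha
    have e : G.component (G.stateAt s' τ) a = c' b := (G.component_eq_iff).2 hab
    have hbq : b = q := by
      by_contra hne
      refine hC.2 (Finset.mem_image.2 ⟨c b, ?_, by rw [hfc, e]⟩)
      exact (G.component_mem_activeSets s).2
        ((G.activeAt_iff s).2 ⟨b, SimpleGraph.Reachable.refl _, hs b hne hb⟩)
    subst hbq
    rw [if_pos hb, e]
    exact Finset.mem_singleton_self _
  have h1 : ∑ C ∈ A' \ A.image f, weight t β τ C ≤ if τ < s' q then 1 + β else 0 := by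
    refine (Finset.sum_le_sum_of_subset_of_nonneg hnew fun C _ _ =>
      zero_le_one.trans (one_le_weight t hβ τ C)).trans ?_
    split_ifs
    · rw [Finset.sum_singleton]
      exact weight_le t hβ τ _
    · simp
  have h2 : ∑ C ∈ A' ∩ A.image f, weight t β τ C ≤ ∑ C ∈ A.image f, weight t β τ C :=
    Finset.sum_le_sum_of_subset_of_nonneg Finset.inter_subset_right fun C _ _ =>
      zero_le_one.trans (one_le_weight t hβ τ C)
  -- One preimage is chosen for each image. Subtracting `1` from the weights isolates the number of
  -- sets, so that each merge counts as a saving of `1`.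
  have h3 : ∑ C ∈ A.image f, (weight t β τ C - 1) ≤ ∑ S ∈ A, (weight t β τ S - 1) := by
    choose! g hgA hgf using fun C (hC : C ∈ A.image f) => Finset.mem_image.1 hC
    calc ∑ C ∈ A.image f, (weight t β τ C - 1)
        ≤ ∑ C ∈ A.image f, (weight t β τ (g C) - 1) :=
          Finset.sum_le_sum fun C hC => sub_le_sub_right (weight_anti t hβ τ (by
            conv_rhs => rw [← hgf C hC]
            exact hsub _)) 1
      _ = ∑ S ∈ (A.image f).image g, (weight t β τ S - 1) :=
          (Finset.sum_image (f := fun S => weight t β τ S - 1) fun C hC D hD h =>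
            (hgf C hC).symm.trans ((congrArg f h).trans (hgf D hD))).symm
      _ ≤ ∑ S ∈ A, (weight t β τ S - 1) :=
          Finset.sum_le_sum_of_subset_of_nonneg (fun S hS => by
            obtain ⟨C, hC, rfl⟩ := Finset.mem_image.1 hS
            exact hgA C hC) fun S _ _ => sub_nonneg.2 (one_le_weight t hβ τ S)
  rw [Finset.sum_sub_distrib, Finset.sum_sub_distrib] at h3
  simp only [Finset.sum_const, nsmul_eq_mul, mul_one] at h3
  have hXA : X.image c ⊆ A := fun S hS => by
    obtain ⟨x, hx, rfl⟩ := Finset.mem_image.1 hS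
    exact (G.component_mem_activeSets s).2 (hX x hx)
  have h4 : (A.image f).card + g ≤ A.card := by
    have e1 : (X.image c).image f = X.image c' := by
      rw [Finset.image_image]
      exact Finset.image_congr fun x _ => hfc x
    have e2 : A.image f = X.image c' ∪ (A \ X.image c).image f := by
      rw [← e1, ← Finset.image_union, Finset.union_sdiff_of_subset hXA]
    have e3 := Finset.card_union_le (X.image c') ((A \ X.image c).image f)
    have e4 := Finset.card_image_le (s := A \ X.image c) (f := f)
    have e5 := Finset.card_sdiff_add_card_eq_card hXA
    rw [e2]
    omega
  have h4' : ((A.image f).card : ℝ) + g ≤ A.card := by exact_mod_cast h4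
  have h5 := Finset.sum_inter_add_sum_sdiff A' (A.image f) (weight t β τ)
  unfold totalWeight
  linarith

end CostGraph

/-! ### The value of a boost -/

namespace CostGraph

variable {V : Type*} [Fintype V] (G : CostGraph V) (t : V → ℝ≥0)

/-- The effect of the boost `(q, σ)` on the weighted growth, if the boost makes the components of
`u, v, w` merge earlier. -/
theorem isValuable_boost {t' : V → ℝ≥0} {β : ℝ} (hβ : 0 ≤ β) {q u v w : V} {σ : ℝ≥0}
    (hσ : t' q < σ) {τ₁ τ₂ ρ₁ ρ₂ : ℝ} (hρ₁ : 0 ≤ ρ₁) (hρ₂ : ρ₁ ≤ ρ₂) (h12 : τ₁ ≤ τ₂)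
    (hact : ∀ τ, 0 ≤ τ → τ < τ₂ → G.ActiveAt t' τ u ∧ G.ActiveAt t' τ v ∧ G.ActiveAt t' τ w)
    (h₁ : ∀ τ, 0 ≤ τ → τ < τ₁ →
      ¬ G.Joined t' τ u v ∧ ¬ G.Joined t' τ u w ∧ ¬ G.Joined t' τ v w)
    (h₂ : ∀ τ, 0 ≤ τ → τ < τ₂ → ¬ (G.Joined t' τ u v ∧ G.Joined t' τ u w))
    (hj₁ : ∀ τ, ρ₁ ≤ τ → τ < τ₂ → G.Joined (boost t' q σ) τ u v)
    (hj₂ : ∀ τ, ρ₂ ≤ τ → τ < τ₂ → G.Joined (boost t' q σ) τ u w)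
    (hle : (1 + β) * σ ≤ (τ₁ - ρ₁) + (τ₂ - ρ₂)) : G.IsValuable t β t' q σ := by
  classical
  set t'' := boost t' q σ with ht''
  have hle'' : ∀ a, t' a ≤ t'' a := fun a => by
    by_cases h : a = q
    · subst h
      rw [ht'', boost_self]
      exact hσ.le
    · rw [ht'', boost_of_ne t' h]
  have hJ : ∀ τ, 0 ≤ τ → ∀ a b, G.Joined t' τ a b → G.Joined t'' τ a b := fun τ hτ a b hab =>
    G.joined_of_joined (M := τ) (fun x c _ _ hc => (G.activeAt_iff t'').2
      ⟨c, SimpleGraph.Reachable.refl _, hc.trans_le (by exact_mod_cast hle'' c)⟩) hτ le_rfl hab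
  set I₁ : ℝ → ℝ := (Set.Ico ρ₁ τ₁).indicator 1 with hI₁
  set I₂ : ℝ → ℝ := (Set.Ico ρ₂ τ₂).indicator 1 with hI₂
  set J : ℝ → ℝ := (Set.Ico 0 (σ : ℝ)).indicator 1 with hJdef
  have hint : ∀ a b : ℝ, MeasureTheory.Integrable ((Set.Ico a b).indicator (1 : ℝ → ℝ)) :=
    fun a b => integrable_indicator_one measurableSet_Ico (by simp)
  -- `I₁` and `I₂` record the two merges gained, `J` the time during which the boosted vertex may
  -- sustain an extra set.
  have key : ∀ τ, G.weightFun t β t'' τ + (I₁ τ + I₂ τ) ≤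
      G.weightFun t β t' τ + (1 + β) * J τ := by
    intro τ
    rcases lt_or_ge τ 0 with hneg | hτ
    · have e1 : I₁ τ = 0 := Set.indicator_of_notMem (fun h => by linarith [h.1]) _
      have e2 : I₂ τ = 0 := Set.indicator_of_notMem (fun h => by linarith [h.1]) _
      have e3 : J τ = 0 := Set.indicator_of_notMem (fun h => by linarith [h.1]) _
      rw [weightFun_of_neg G t β _ hneg, weightFun_of_neg G t β _ hneg, e1, e2, e3]
      simp
    rw [weightFun_of_nonneg G t β _ hτ, weightFun_of_nonneg G t β _ hτ]
    have hnewq : (if τ < t'' q then 1 + β else 0) = (1 + β) * J τ := by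
      rw [ht'', boost_self]
      simp only [hJdef, Set.indicator, Set.mem_Ico, hτ, true_and]
      split_ifs <;> simp
    have main : ∀ (X : Finset V), (∀ x ∈ X, G.ActiveAt t' τ x) → ∀ g : ℕ,
        (X.image (G.component (G.stateAt t'' τ))).card + g ≤
          (X.image (G.component (G.stateAt t' τ))).card →
        I₁ τ + I₂ τ ≤ g →
        G.totalWeight t β t'' τ + (I₁ τ + I₂ τ) ≤
          G.totalWeight t β t' τ + (1 + β) * J τ := by
      intro X hX g hg hIg
      have := G.totalWeight_add_le t hβ (hJ τ hτ) (q := q)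
        (fun a ha h => by rwa [ht'', boost_of_ne t' ha] at h) X hX hg
      rw [hnewq] at this
      linarith
    have neq : ∀ {s : V → ℝ≥0} {a b : V}, ¬ G.Joined s τ a b →
        G.component (G.stateAt s τ) a ≠ G.component (G.stateAt s τ) b := fun h h' =>
      h ((G.component_eq_iff).1 h')
    have eq : ∀ {s : V → ℝ≥0} {a b : V}, G.Joined s τ a b →
        G.component (G.stateAt s τ) a = G.component (G.stateAt s τ) b := fun h =>
      (G.component_eq_iff).2 h
    by_cases m₁ : τ ∈ Set.Ico ρ₁ τ₁
    · have i₁ : I₁ τ = 1 := Set.indicator_of_mem m₁ _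
      have hτ₂ := m₁.2.trans_le h12
      obtain ⟨a₁, a₂, a₃⟩ := hact τ hτ hτ₂
      obtain ⟨n₁, n₂, n₃⟩ := h₁ τ hτ m₁.2
      have huv := eq (hj₁ τ m₁.1 hτ₂)
      have hX : ∀ x ∈ ({u, v, w} : Finset V), G.ActiveAt t' τ x := by
        simp [a₁, a₂, a₃]
      have c₁ : (({u, v, w} : Finset V).image (G.component (G.stateAt t' τ))).card = 3 := by
        simp only [Finset.image_insert, Finset.image_singleton]
        exact Finset.card_eq_three.2 ⟨_, _, _, neq n₁, neq n₂, neq n₃, rfl⟩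
      by_cases m₂ : τ ∈ Set.Ico ρ₂ τ₂
      · have i₂ : I₂ τ = 1 := Set.indicator_of_mem m₂ _
        refine main {u, v, w} hX 2 ?_ (by rw [i₁, i₂]; norm_num)
        rw [c₁]
        simp only [Finset.image_insert, Finset.image_singleton]
        rw [← huv, ← eq (hj₂ τ m₂.1 m₂.2)]
        simp
      · have i₂ : I₂ τ = 0 := Set.indicator_of_notMem m₂ _
        refine main {u, v, w} hX 1 ?_ (by rw [i₁, i₂]; norm_num)
        rw [c₁]
        simp only [Finset.image_insert, Finset.image_singleton]
        rw [← huv]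
        simp only [Finset.mem_insert, Finset.mem_singleton, true_or, Finset.insert_eq_of_mem]
        exact Nat.add_le_add_right Finset.card_le_two 1
    · have i₁ : I₁ τ = 0 := Set.indicator_of_notMem m₁ _
      by_cases m₂ : τ ∈ Set.Ico ρ₂ τ₂
      · have i₂ : I₂ τ = 1 := Set.indicator_of_mem m₂ _
        obtain ⟨a₁, a₂, a₃⟩ := hact τ hτ m₂.2
        have pair : ∀ x, G.ActiveAt t' τ x → ¬ G.Joined t' τ u x → G.Joined t'' τ u x →
            G.totalWeight t β t'' τ + (I₁ τ + I₂ τ) ≤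
              G.totalWeight t β t' τ + (1 + β) * J τ := by
          intro x hx hn hj
          refine main {u, x} (by simp [a₁, hx]) 1 ?_ (by rw [i₁, i₂]; norm_num)
          simp only [Finset.image_insert, Finset.image_singleton]
          rw [Finset.card_pair (neq hn), ← eq hj]
          simp
        -- By `h₂`, one of `v`, `w` is still separated from `u` under `t'`, while after `ρ₂` both
        -- are joined with `u` in the boosted execution.
        by_cases hw : G.Joined t' τ u w
        · exact pair v a₂ (fun h => h₂ τ hτ m₂.2 ⟨h, hw⟩) (hj₁ τ (hρ₂.trans m₂.1) m₂.2)
        · exact pair w a₃ hw (hj₂ τ m₂.1 m₂.2)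
      · have i₂ : I₂ τ = 0 := Set.indicator_of_notMem m₂ _
        exact main ∅ (by simp) 0 (by simp) (by rw [i₁, i₂]; norm_num)
  have hmono := MeasureTheory.integral_mono
    ((G.integrable_weightFun t β t'').add ((hint ρ₁ τ₁).add (hint ρ₂ τ₂)))
    ((G.integrable_weightFun t β t').add ((hint 0 (σ : ℝ)).const_mul (1 + β))) key
  rw [MeasureTheory.integral_add' (G.integrable_weightFun t β t'')
      ((hint ρ₁ τ₁).add (hint ρ₂ τ₂)),
    MeasureTheory.integral_add' (G.integrable_weightFun t β t')
      ((hint 0 (σ : ℝ)).const_mul (1 + β)), MeasureTheory.integral_const_mul,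
    MeasureTheory.integral_add' (hint ρ₁ τ₁) (hint ρ₂ τ₂),
    MeasureTheory.integral_indicator_one measurableSet_Ico,
    MeasureTheory.integral_indicator_one measurableSet_Ico,
    MeasureTheory.integral_indicator_one measurableSet_Ico, integral_weightFun,
    integral_weightFun, Real.volume_real_Ico, Real.volume_real_Ico, Real.volume_real_Ico] at hmono
  -- An interval may be empty, with `ρ₁ > τ₁` for instance; truncating its length at `0` only
  -- strengthens the bound.
  have k1 := le_max_left (τ₁ - ρ₁) 0
  have k2 := le_max_left (τ₂ - ρ₂) 0
  have k3 : max ((σ : ℝ) - 0) 0 = σ := by simp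
  rw [k3] at hmono
  unfold IsValuable win loss
  rw [← ht'']
  linarith

end CostGraph

/-! ### The claw inequality for a fixed centre -/

namespace CostGraph

variable {V : Type*} [Fintype V] (G : CostGraph V) (t : V → ℝ≥0)

/-- The claw inequality for the merging moments `ρu ≤ ρv ≤ ρw` of the claw center `q`, in the
execution in which `q` keeps growing, with `u`, `v`, `w`. -/
theorem add_le_of_merging_moments {t' : V → ℝ≥0} {β : ℝ} (hβ : 0 ≤ β)
    (hmax : ∀ a σ, G.IsCandidate t' a σ → ¬ G.IsValuable t β t' a σ) {u v w q : V} {τ₁ τ₂ : ℝ}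
    (h12 : τ₁ ≤ τ₂)
    (hact : ∀ τ, 0 ≤ τ → τ < τ₂ → G.ActiveAt t' τ u ∧ G.ActiveAt t' τ v ∧ G.ActiveAt t' τ w)
    (h₁ : ∀ τ, 0 ≤ τ → τ < τ₁ → ¬ ∃ c, (G.Joined t' τ c u ∧ G.Joined t' τ c v) ∨
      (G.Joined t' τ c u ∧ G.Joined t' τ c w) ∨ (G.Joined t' τ c v ∧ G.Joined t' τ c w))
    (h₂ : ∀ τ, 0 ≤ τ → τ < τ₂ →
      ¬ ∃ c, G.Joined t' τ c u ∧ G.Joined t' τ c v ∧ G.Joined t' τ c w)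
    {T : ℝ≥0} (hqT : t' q ≤ T) (hT : τ₂ ≤ T) {ρu ρv ρw : ℝ} (hρ0 : 0 ≤ ρu) (huv : ρu ≤ ρv)
    (hvw : ρv ≤ ρw) (hwτ : ρw ≤ τ₂)
    (hnu : ∀ τ, 0 ≤ τ → τ < ρu → ¬ G.Joined (boost t' q T) τ q u)
    (hu : ρu < τ₂ → G.Joined (boost t' q T) ρu q u)
    (hv : ρv < τ₂ → G.Joined (boost t' q T) ρv q v)
    (hw : ρw < τ₂ → G.Joined (boost t' q T) ρw q w) :
    τ₁ + τ₂ ≤ ρu + ρv + ρw + β * ρu := by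
  have hβρ : 0 ≤ β * ρu := mul_nonneg hβ hρ0
  -- If `ρu = τ₂`, all three moments equal `τ₂` and the bound is immediate.
  rcases (huv.trans (hvw.trans hwτ)).eq_or_lt with heq | hlt
  · linarith
  have hu := hu hlt
  set tT := boost t' q T with htT
  have self_joined : ∀ {s : V → ℝ≥0} {τ : ℝ} {a : V}, G.Joined s τ a a := fun {s τ a} =>
    SimpleGraph.Reachable.refl _
  have self_active : ∀ {s : V → ℝ≥0} {τ : ℝ} {a : V}, τ < s a → G.ActiveAt s τ a := fun h =>
    (G.activeAt_iff _).2 ⟨_, self_joined, h⟩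
  -- while the boost of `q` lasts at least until `ρu`, the execution does not depend on it
  have transfer : ∀ (s : V → ℝ≥0) (S : ℝ≥0), (∀ a, a ≠ q → s a = t' a) → s q = S → t' q ≤ S →
      ρu ≤ S → ∀ τ, 0 ≤ τ → τ ≤ τ₂ → ∀ a b, G.Joined tT τ a b → G.Joined s τ a b := by
    intro s S hs hsq htS hρS
    have hts : ∀ a, t' a ≤ s a := fun a => by
      by_cases h : a = q
      · rw [h, hsq]; exact htS
      · rw [hs a h]
    have hear : G.Joined s ρu q u := by
      refine G.joined_of_joined (t₁ := tT) (M := ρu) (fun τ a _ h1 h2 => ?_) hρ0 le_rfl hu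
      refine self_active ?_
      by_cases h : a = q
      · rw [h, hsq]; exact h1.trans_le hρS
      · rwa [hs a h, ← boost_of_ne t' h T]
    have hbase : ∀ τ, 0 ≤ τ → ∀ a b, G.Joined t' τ a b → G.Joined s τ a b := fun τ hτ a b hab =>
      G.joined_of_joined (M := τ) (fun x c _ _ hc =>
        self_active (hc.trans_le (by exact_mod_cast hts c))) hτ le_rfl hab
    intro τ hτ hτ₂ a b hab
    refine G.joined_of_joined (t₁ := tT) (M := τ₂) (fun x c hx hx₂ hc => ?_) hτ hτ₂ hab
    by_cases h : c = q
    · subst h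
      by_cases hxs : x < s c
      · exact self_active hxs
      -- The own time of `q` is over, but `q` has joined `u` by then, and the component of `u` is
      -- active until `τ₂`.
      · rw [hsq] at hxs
        have hρx : ρu ≤ x := hρS.trans (not_lt.1 hxs)
        obtain ⟨d, hd, hdl⟩ := (G.activeAt_iff t').1 (hact x hx hx₂).1
        exact (hear.mono hρ0 hρx).activeAt ((G.activeAt_iff s).2
          ⟨d, hbase x hx _ _ hd, hdl.trans_le (by exact_mod_cast hts d)⟩)
    · refine self_active ?_
      rwa [hs c h, ← boost_of_ne t' h T]
  have ends : ∀ (s : V → ℝ≥0),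
      (∀ τ, 0 ≤ τ → τ ≤ τ₂ → ∀ a b, G.Joined tT τ a b → G.Joined s τ a b) →
      (∀ τ, ρv ≤ τ → τ < τ₂ → G.Joined s τ q u ∧ G.Joined s τ q v) ∧
      (∀ τ, ρw ≤ τ → τ < τ₂ → G.Joined s τ q u ∧ G.Joined s τ q w) := by
    intro s hs
    refine ⟨fun τ h1 h2 => ?_, fun τ h1 h2 => ?_⟩
    · have h0 : 0 ≤ τ := hρ0.trans (huv.trans h1)
      exact ⟨hs τ h0 h2.le _ _ (hu.mono hρ0 (huv.trans h1)),
        hs τ h0 h2.le _ _ ((hv (h1.trans_lt h2)).mono (hρ0.trans huv) h1)⟩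
    · have h0 : 0 ≤ τ := hρ0.trans (huv.trans (hvw.trans h1))
      exact ⟨hs τ h0 h2.le _ _ (hu.mono hρ0 (huv.trans (hvw.trans h1))),
        hs τ h0 h2.le _ _ ((hw (h1.trans_lt h2)).mono (hρ0.trans (huv.trans hvw)) h1)⟩
  rcases le_or_gt ρu (t' q) with hle | hgt
  · obtain ⟨e₁, e₂⟩ := ends t' (transfer t' (t' q) (fun _ _ => rfl) rfl le_rfl hle)
    have k₁ : τ₁ ≤ ρv := by
      by_contra! hcon
      obtain ⟨j₁, j₂⟩ := e₁ ρv le_rfl (hcon.trans_le h12)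
      exact h₁ ρv (hρ0.trans huv) hcon ⟨q, Or.inl ⟨j₁, j₂⟩⟩
    have k₂ : τ₂ ≤ ρw := by
      by_contra! hcon
      obtain ⟨j₁, j₂⟩ := e₂ ρw le_rfl hcon
      have j₃ := (e₁ ρw hvw hcon).2
      exact h₂ ρw (hρ0.trans (huv.trans hvw)) hcon ⟨q, j₁, j₃, j₂⟩
    linarith
  · lift ρu to ℝ≥0 using hρ0
    have hgt' : t' q < ρu := by exact_mod_cast hgt
    have hcand : G.IsCandidate t' q ρu := by
      refine ⟨hgt', ?_⟩
      -- Every value from `ρu` on works. Up to `ρu` the executions with values `S` and `T` agree on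
      -- joins, as `q` is active in both.
      filter_upwards [Filter.eventually_ge_atTop ρu] with S hS
      have hSself := boost_self t' q S
      have hTself := boost_self t' q T
      have hts : ∀ a, t' a ≤ boost t' q S a := fun a => by
        by_cases h : a = q
        · rw [h, hSself]; exact hgt'.le.trans hS
        · rw [boost_of_ne t' h]
      have hback : ∀ τ : ℝ, 0 ≤ τ → τ ≤ ρu → ∀ a b,
          G.Joined (boost t' q S) τ a b → G.Joined tT τ a b := fun τ hτ hτρ a b hab => by
        refine G.joined_of_joined (M := ρu) (fun x c _ hx hc => self_active ?_) hτ hτρ hab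
        by_cases h : c = q
        · rw [h, htT, hTself]; exact hx.trans (hlt.trans_le hT)
        · rwa [htT, boost_of_ne t' h, ← boost_of_ne t' h S]
      refine G.exists_merge (boost t' q S) (q := q) (u := u) ((t' q).coe_nonneg.trans_lt hgt)
        (fun τ h0 hτ => ⟨fun h => hnu τ h0 hτ (hback τ h0 hτ.le _ _ h), self_active ?_, ?_⟩) ?_
      · rw [hSself]; exact hτ.trans_le (by exact_mod_cast hS)
      · obtain ⟨d, hd, hdl⟩ := (G.activeAt_iff t').1 (hact τ h0 (hτ.trans hlt)).1
        refine (G.activeAt_iff _).2 ⟨d, ?_, hdl.trans_le (by exact_mod_cast hts d)⟩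
        exact G.joined_of_joined (M := τ) (fun x c _ _ hc =>
          self_active (hc.trans_le (by exact_mod_cast hts c))) h0 le_rfl hd
      · exact transfer _ S (fun a ha => boost_of_ne t' ha S) hSself (hgt'.le.trans hS)
          (by exact_mod_cast hS) _ ρu.coe_nonneg hlt.le _ _ hu
    obtain ⟨e₁, e₂⟩ := ends (boost t' q ρu) (transfer _ ρu (fun a ha => boost_of_ne t' ha ρu)
      (boost_self t' q ρu) hgt'.le le_rfl)
    -- The negated bound supplies `(1 + β) * ρu ≤ (τ₁ - ρv) + (τ₂ - ρw)`, the condition for the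
    -- boost `(q, ρu)` to pay off.
    by_contra! hcon
    refine hmax q ρu hcand (G.isValuable_boost t hβ hgt' (ρu.coe_nonneg.trans huv) hvw h12 hact
      (fun τ h0 hτ => ⟨fun h => h₁ τ h0 hτ ⟨u, Or.inl ⟨self_joined, h⟩⟩,
        fun h => h₁ τ h0 hτ ⟨u, Or.inr (Or.inl ⟨self_joined, h⟩)⟩,
        fun h => h₁ τ h0 hτ ⟨v, Or.inr (Or.inr ⟨self_joined, h⟩)⟩⟩)
      (fun τ h0 hτ h => h₂ τ h0 hτ ⟨u, self_joined, h.1, h.2⟩)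
      (fun τ h1 h2 => SimpleGraph.Reachable.trans (e₁ τ h1 h2).1.symm (e₁ τ h1 h2).2)
      (fun τ h1 h2 => SimpleGraph.Reachable.trans (e₂ τ h1 h2).1.symm (e₂ τ h1 h2).2) ?_)
    linarith

/-- The claw inequality for one claw center. -/
theorem ofReal_add_le {t' : V → ℝ≥0} {β : ℝ} (hβ : 0 ≤ β)
    (hmax : ∀ a σ, G.IsCandidate t' a σ → ¬ G.IsValuable t β t' a σ) {u v w : V} {τ₁ τ₂ : ℝ}
    (h0 : 0 ≤ τ₁) (h12 : τ₁ ≤ τ₂)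
    (hact : ∀ τ, 0 ≤ τ → τ < τ₂ → G.ActiveAt t' τ u ∧ G.ActiveAt t' τ v ∧ G.ActiveAt t' τ w)
    (h₁ : ∀ τ, 0 ≤ τ → τ < τ₁ → ¬ ∃ c, (G.Joined t' τ c u ∧ G.Joined t' τ c v) ∨
      (G.Joined t' τ c u ∧ G.Joined t' τ c w) ∨ (G.Joined t' τ c v ∧ G.Joined t' τ c w))
    (h₂ : ∀ τ, 0 ≤ τ → τ < τ₂ →
      ¬ ∃ c, G.Joined t' τ c u ∧ G.Joined t' τ c v ∧ G.Joined t' τ c w) (q : V) :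
    ENNReal.ofReal (τ₁ + τ₂) ≤ (G.dist q u + G.dist q v + G.dist q w) / 2 +
      ENNReal.ofReal β * (min (G.dist q u) (min (G.dist q v) (G.dist q w)) / 2) := by
  have h02 := h0.trans h12
  -- Large enough to keep `q` active up to `τ₂`, and not below `t' q`, so that the boosted execution
  -- dominates.
  set T : ℝ≥0 := max (t' q) τ₂.toNNReal with hTdef
  have hqT : t' q ≤ T := le_max_left _ _
  have hT : τ₂ ≤ T := (Real.le_coe_toNNReal τ₂).trans (by exact_mod_cast le_max_right _ _)
  set tT := boost t' q T with htT
  have hts : ∀ a, t' a ≤ tT a := fun a => by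
    by_cases h : a = q
    · rw [h, htT, boost_self]; exact hqT
    · rw [htT, boost_of_ne t' h]
  have self_active : ∀ {τ : ℝ} {a : V}, τ < tT a → G.ActiveAt tT τ a := fun h =>
    (G.activeAt_iff _).2 ⟨_, SimpleGraph.Reachable.refl _, h⟩
  have active_lift : ∀ τ, 0 ≤ τ → ∀ x, G.ActiveAt t' τ x → G.ActiveAt tT τ x := by
    intro τ hτ x hx
    obtain ⟨d, hd, hdl⟩ := (G.activeAt_iff t').1 hx
    refine (G.activeAt_iff _).2 ⟨d, ?_, hdl.trans_le (by exact_mod_cast hts d)⟩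
    exact G.joined_of_joined (M := τ) (fun y c _ _ hc =>
      self_active (hc.trans_le (by exact_mod_cast hts c))) hτ le_rfl hd
  have moment : ∀ x, (∀ τ, 0 ≤ τ → τ < τ₂ → G.ActiveAt t' τ x) →
      ∃ r, 0 ≤ r ∧ r ≤ τ₂ ∧ (∀ τ, 0 ≤ τ → τ < r → ¬ G.Joined tT τ q x) ∧
        (r < τ₂ → G.Joined tT r q x) ∧ ENNReal.ofReal r ≤ G.dist q x / 2 := by
    intro x hx
    obtain ⟨r, r0, r1, r2, r3⟩ := exists_first_moment (P := fun τ => G.Joined tT τ q x) h02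
      (fun τ hτ => by
        obtain ⟨ε, hε, h⟩ := G.exists_joined_right tT hτ
        exact ⟨ε, hε, fun σ h1 h2 => (h σ h1 h2 q x).1⟩)
    refine ⟨r, r0, r1, r2, r3, G.ofReal_le_dist_div_two tT r0 fun τ t0 t1 => ⟨r2 τ t0 t1, ?_,
      active_lift τ t0 x (hx τ t0 (t1.trans_le r1))⟩⟩
    refine self_active ?_
    rw [htT, boost_self]
    exact t1.trans_le (r1.trans hT)
  obtain ⟨ρu, u0, u1, u2, u3, u4⟩ := moment u fun τ a b => (hact τ a b).1
  obtain ⟨ρv, v0, v1, v2, v3, v4⟩ := moment v fun τ a b => (hact τ a b).2.1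
  obtain ⟨ρw, w0, w1, w2, w3, w4⟩ := moment w fun τ a b => (hact τ a b).2.2
  have main : τ₁ + τ₂ ≤ ρu + ρv + ρw + β * min ρu (min ρv ρw) := by
    -- The hypotheses are symmetric in `u, v, w`. Stating this for arbitrary predicates lets one
    -- inequality serve every order of the merging moments.
    have perm : ∀ {x y z : V} {ρx ρy ρz : ℝ}, ρx ≤ ρy → ρy ≤ ρz → 0 ≤ ρx → ρz ≤ τ₂ →
        (∀ τ, 0 ≤ τ → τ < ρx → ¬ G.Joined tT τ q x) → (ρx < τ₂ → G.Joined tT ρx q x) →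
        (ρy < τ₂ → G.Joined tT ρy q y) → (ρz < τ₂ → G.Joined tT ρz q z) →
        (∀ P : V → Prop, P u ∧ P v ∧ P w ↔ P x ∧ P y ∧ P z) →
        (∀ P : V → Prop, (P u ∧ P v) ∨ (P u ∧ P w) ∨ (P v ∧ P w) ↔
          (P x ∧ P y) ∨ (P x ∧ P z) ∨ (P y ∧ P z)) →
        τ₁ + τ₂ ≤ ρx + ρy + ρz + β * ρx := fun hxy hyz hx hz nx jx jy jz p₁ p₂ =>
      G.add_le_of_merging_moments t hβ hmax h12
        (fun τ a b => (p₁ (G.ActiveAt t' τ)).1 (hact τ a b))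
        (fun τ a b ⟨c, hc⟩ => h₁ τ a b ⟨c, (p₂ (G.Joined t' τ c)).2 hc⟩)
        (fun τ a b ⟨c, hc⟩ => h₂ τ a b ⟨c, (p₁ (G.Joined t' τ c)).2 hc⟩)
        hqT hT hx hxy hyz hz nx jx jy jz
    rcases le_total ρu ρv with a | a <;> rcases le_total ρu ρw with b | b <;>
      rcases le_total ρv ρw with c | c
    · have := perm a c u0 w1 u2 u3 v3 w3
        (fun P => by clear * -; tauto) (fun P => by clear * -; tauto)
      rw [min_eq_left c, min_eq_left a]; linarith
    · have := perm b c u0 v1 u2 u3 w3 v3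
        (fun P => by clear * -; tauto) (fun P => by clear * -; tauto)
      rw [min_eq_right c, min_eq_left b]; linarith
    · have := perm a c u0 w1 u2 u3 v3 w3
        (fun P => by clear * -; tauto) (fun P => by clear * -; tauto)
      rw [min_eq_left c, min_eq_left a]; linarith
    · have := perm b a w0 v1 w2 w3 u3 v3
        (fun P => by clear * -; tauto) (fun P => by clear * -; tauto)
      rw [min_eq_right c, min_eq_right b]; linarith
    · have := perm a b v0 w1 v2 v3 u3 w3
        (fun P => by clear * -; tauto) (fun P => by clear * -; tauto)
      rw [min_eq_left c, min_eq_right a]; linarith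
    · have := perm c a w0 u1 w2 w3 v3 u3
        (fun P => by clear * -; tauto) (fun P => by clear * -; tauto)
      rw [min_eq_right c, min_eq_right (c.trans a)]; linarith
    · have := perm c b v0 u1 v2 v3 w3 u3
        (fun P => by clear * -; tauto) (fun P => by clear * -; tauto)
      rw [min_eq_left c, min_eq_right a]; linarith
    · have := perm c a w0 u1 w2 w3 v3 u3
        (fun P => by clear * -; tauto) (fun P => by clear * -; tauto)
      rw [min_eq_right c, min_eq_right b]; linarith
  set m := min ρu (min ρv ρw) with hm
  have m0 : 0 ≤ m := le_min u0 (le_min v0 w0)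
  have hmd : ENNReal.ofReal m ≤ min (G.dist q u) (min (G.dist q v) (G.dist q w)) / 2 := by
    have e : ∀ x ρ, m ≤ ρ → ENNReal.ofReal ρ ≤ G.dist q x / 2 →
        ENNReal.ofReal m * 2 ≤ G.dist q x := fun x ρ h h' =>
      (ENNReal.le_div_iff_mul_le (by simp) (by simp)).1 ((ENNReal.ofReal_le_ofReal h).trans h')
    rw [ENNReal.le_div_iff_mul_le (by simp) (by simp)]
    exact le_min (e u ρu (min_le_left _ _) u4) (le_min
      (e v ρv ((min_le_right _ _).trans (min_le_left _ _)) v4)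
      (e w ρw ((min_le_right _ _).trans (min_le_right _ _)) w4))
  refine (ENNReal.ofReal_le_ofReal main).trans ?_
  rw [ENNReal.ofReal_add (by positivity) (by positivity), ENNReal.ofReal_add (by positivity) w0,
    ENNReal.ofReal_add u0 v0, ENNReal.ofReal_mul hβ, ENNReal.add_div, ENNReal.add_div]
  gcongr

end CostGraph

/-! ### Existence of the two first moments and conclusion -/

theorem mainTheorem3 {V : Type*} [Fintype V] (G : CostGraph V) (t t' : V → ℝ≥0) (β : ℝ)
    (hβ0 : 0 < β) (hβ1 : β < 1) (hLS : G.IsLocalSearchOutput t β t')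
    (u v w : V) (huvw : G.ActivelyConnected t' {u, v, w}) :
    ∃ τ τ' : ℝ,
      IsLeast {σ | ∃ S, G.IsActiveAt t' σ S ∧
        ((u ∈ S ∧ v ∈ S) ∨ (u ∈ S ∧ w ∈ S) ∨ (v ∈ S ∧ w ∈ S))} τ ∧
      IsLeast {σ | ∃ S, G.IsActiveAt t' σ S ∧ u ∈ S ∧ v ∈ S ∧ w ∈ S} τ' ∧
      ∀ q : V, ENNReal.ofReal (τ + τ') ≤
        (G.dist q u + G.dist q v + G.dist q w) / 2 +
          ENNReal.ofReal β * (min (G.dist q u) (min (G.dist q v) (G.dist q w)) / 2) := by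
  obtain ⟨σ₀, ⟨S₀, hS₀, hsub⟩, hgrow⟩ := huvw
  have hσ₀ : 0 ≤ σ₀ := by
    obtain ⟨⟨n, hn, -⟩, -⟩ := hS₀
    exact hn.nonneg
  have hu₀ : u ∈ S₀ := hsub (by simp)
  have hv₀ : v ∈ S₀ := hsub (by simp)
  have hw₀ : w ∈ S₀ := hsub (by simp)
  have mem_joined : ∀ {σ S}, G.IsActiveAt t' σ S → 0 ≤ σ ∧ ∃ c, ∀ x, x ∈ S ↔ G.Joined t' σ c x := by
    rintro σ S ⟨hc, -⟩
    have h0 : 0 ≤ σ := by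
      obtain ⟨n, hn, -⟩ := hc
      exact hn.nonneg
    obtain ⟨c, rfl⟩ := (G.mem_components).1 ((G.isComponentAt_iff t' h0).1 hc)
    exact ⟨h0, c, fun x => G.mem_component⟩
  have active : ∀ {a}, a ∈ ({u, v, w} : Set V) → ∀ τ, 0 ≤ τ → τ < σ₀ → G.ActiveAt t' τ a := by
    intro a ha τ h0 hτ
    obtain ⟨S, hS, haS⟩ := hgrow a ha τ h0 hτ
    have hS' := (G.growsAt_iff t' h0).1 hS
    rw [← G.component_eq_of_mem (G.mem_components_of_mem_activeSets t' hS') haS] at hS'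
    exact (G.component_mem_activeSets t').1 hS'
  -- the first moment of an event that concerns one component, and the set witnessing it
  have first : ∀ Q : (V → Prop) → Prop, Q (· ∈ S₀) →
      (∀ P, Q P → P u ∨ P v ∨ P w) →
      ∃ τ, 0 ≤ τ ∧ τ ≤ σ₀ ∧ IsLeast {σ | ∃ S, G.IsActiveAt t' σ S ∧ Q (· ∈ S)} τ ∧
        ∀ σ, 0 ≤ σ → σ < τ → ¬ ∃ c, Q (G.Joined t' σ c) := by
    intro Q hQ hQP
    obtain ⟨r, r0, r1, r2, r3⟩ := exists_first_moment (P := fun τ => ∃ c, Q (G.Joined t' τ c)) hσ₀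
      (fun τ hτ => by
        obtain ⟨ε, hε, h⟩ := G.exists_joined_right t' hτ
        refine ⟨ε, hε, fun σ h1 h2 ⟨c, hc⟩ => ⟨c, ?_⟩⟩
        rwa [show G.Joined t' τ c = G.Joined t' σ c from
          funext fun x => (propext (h σ h1 h2 c x)).symm])
    refine ⟨r, r0, r1, ⟨?_, ?_⟩, r2⟩
    -- At the cap `σ₀` only the given set `S₀` can be used, as it may be deactivated at once.
    -- Earlier, the component found is still growing.
    · rcases r1.eq_or_lt with rfl | hlt
      · exact ⟨S₀, hS₀, hQ⟩
      · obtain ⟨c, hc⟩ := r3 hlt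
        have hca : G.ActiveAt t' r c := by
          rcases hQP _ hc with h | h | h
          · exact h.activeAt (active (by simp) r r0 hlt)
          · exact h.activeAt (active (by simp) r r0 hlt)
          · exact h.activeAt (active (by simp) r r0 hlt)
        have hmem := (G.component_mem_activeSets t').2 hca
        refine ⟨G.component (G.stateAt t' r) c,
          ⟨(G.isComponentAt_iff t' r0).2 (G.mem_components_of_mem_activeSets t' hmem),
            Or.inl ((G.growsAt_iff t' r0).2 hmem)⟩, ?_⟩
        rwa [show (· ∈ G.component (G.stateAt t' r) c) = G.Joined t' r c from
          funext fun x => propext G.mem_component]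
    · rintro σ ⟨S, hS, hQS⟩
      obtain ⟨h0, c, hc⟩ := mem_joined hS
      by_contra! hcon
      refine r2 σ h0 hcon ⟨c, ?_⟩
      rwa [show G.Joined t' σ c = (· ∈ S) from funext fun x => (propext (hc x)).symm]
  obtain ⟨τ₁, a0, -, a2, a3⟩ := first (fun P => (P u ∧ P v) ∨ (P u ∧ P w) ∨ (P v ∧ P w))
    (Or.inl ⟨hu₀, hv₀⟩) (by tauto)
  obtain ⟨τ₂, -, b1, b2, b3⟩ := first (fun P => P u ∧ P v ∧ P w) ⟨hu₀, hv₀, hw₀⟩ (by tauto)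
  have h12 : τ₁ ≤ τ₂ := by
    obtain ⟨S, hS, h⟩ := b2.1
    exact a2.2 ⟨S, hS, Or.inl ⟨h.1, h.2.1⟩⟩
  refine ⟨τ₁, τ₂, a2, b2, fun q => G.ofReal_add_le t hβ0.le hLS.2 a0 h12 (fun τ h0 hτ => ?_)
    a3 b3 q⟩
  have hτ' := hτ.trans_le b1
  exact ⟨active (by simp) τ h0 hτ', active (by simp) τ h0 hτ', active (by simp) τ h0 hτ'⟩
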